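/- Let $\mathbb T=\mathbb R/\mathbb Z$ and let $L^1(\mathbb T)$ be the Banach space of complex-valued Lebesgue-integrable functions on $\mathbb T$ (modulo equality almost everywhere), with the norm $\|f\|_1=\int_{\mathbb T}|f|$. For $f\in L^1(\mathbb T)$ and $n\ge 0$ let $S_nf(x)=\sum_{k=-n}^{n}\hat f(k)e^{2\pi i kx}$, with $\hat f(k)=\int_{\mathbb T}f(t)e^{-2\pi i kt}\,dt$, be the $n$-th partial sum of the Fourier series of $f$. For $\beta\in\mathbb R$ put $$E(\beta,f)=\Big\{x\in\mathbb T:\ \limsup_{n\to+\infty}\frac{\log|S_nf(x)|}{\log n}=\beta\Big\}$$ (with $\log 0=-\infty$). Then for quasi-all $f\in L^1(\mathbb T)$, that is, for all $f$ in a residual (comeagre) subset of $L^1(\mathbb T)$, the Hausdorff dimension of $E(\beta,f)$ satisfies $$\dim_{\mathcal H}E(\beta,f)=1-\beta\qquad\text{for every }\beta\in[0,1].$$ -/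

import Mathlib

open MeasureTheory Filter
open scoped ENNReal

/-- The space `L¹(𝕋)` of (classes of) integrable complex functions on the circle `𝕋 = ℝ/ℤ`,
with its normalized Lebesgue (Haar) measure and the `L¹` norm. -/
abbrev L1Circle : Type :=
  Lp ℂ 1 (AddCircle.haarAddCircle : Measure UnitAddCircle)

/-- The `n`-th partial sum `S_n f (x) = ∑_{k=-n}^{n} ⟨f, e_k⟩ e_k(x)` of the Fourier series of `f`,
where `e_k(x) = exp (2 π i k x)`. -/
noncomputable def fourierPartialSum (n : ℕ) (f : UnitAddCircle → ℂ) (x : UnitAddCircle) : ℂ :=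
  ∑ k ∈ Finset.Icc (-(n : ℤ)) (n : ℤ), fourierCoeff f k * fourier k x

/-- The level set `E(β, f)` of all `x` with `limsup_{n → ∞} log |S_n f (x)| / log n = β`.
The logarithm and the upper limit are taken in the extended reals, with `log 0 = -∞`. -/
noncomputable def divergenceLevelSet (β : ℝ) (f : UnitAddCircle → ℂ) : Set UnitAddCircle :=
  {x | limsup (fun n : ℕ => ENNReal.log ‖fourierPartialSum n f x‖ₑ / ((Real.log n : ℝ) : EReal))
    atTop = (β : EReal)}

/-!
The upper bound holds for every integrable `f`. Splitting the Dirichlet kernel dyadically,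
`|S_n f (x)|` is bounded by the sum over `2 ^ k ≤ n` of `2 ^ (k + 2) μ (B (x, 2⁻ᵏ))`, where
`μ = |f| dt`. So if `|S_n f (x)| ≥ n ^ γ` infinitely often, then `μ (B (x, r)) ≥ r ^ s` for
arbitrarily small `r` whenever `1 - γ < s < 1`, and by the Vitali covering lemma the set of such `x`
has dimension at most `s`.

For the lower bound, trigonometric polynomials are dense, so quasi-all `f` are infinitely often very
close to a polynomial of degree `N` plus `N⁻¹` times a Fejér kernel dilated by `2 ^ N`. At a point
whose binary digits vanish at the positions from `N` to `N + j + 2`, that is, which lies within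
`2 ^ (-N - j - 3)` of a multiple of `2⁻ᴺ`, the partial sum of order `2 ^ (N + j)` then has size
about `2 ^ j / N`, which exceeds the `β`-th power of the order once `j` is slightly larger than
`β N / (1 - β)`. Prescribing such gaps in the digits along a very sparse sequence of `N` leaves a
Cantor set whose uniform measure `ν` satisfies `ν ≤ μH[s]` for all `s < 1 - β`. By the upper
bound, `ν` does not charge the points at which the growth exponent is larger than `β`.
-/

open scoped NNReal Topology

section Hausdorff

variable {X : Type*} [MetricSpace X] [MeasurableSpace X] [BorelSpace X]

lemma exists_countable_cover_closedBall {μ : Measure X} [SFinite μ] {s : ℝ} {A : Set X}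
    {η : ℝ} (hA : ∀ x ∈ A, ∃ r, 0 < r ∧ r ≤ η ∧
      ENNReal.ofReal r ^ s ≤ μ (Metric.closedBall x r)) :
    ∃ u : Set (X × ℝ), u.Countable ∧ (∀ p ∈ u, p.2 ≤ η) ∧
      A ⊆ ⋃ p : u, Metric.closedBall p.1.1 (5 * p.1.2) ∧
      ∑' p : u, ENNReal.ofReal p.1.2 ^ s ≤ μ Set.univ := by
  let good : Set (X × ℝ) :=
    {p | 0 < p.2 ∧ p.2 ≤ η ∧ ENNReal.ofReal p.2 ^ s ≤ μ (Metric.closedBall p.1 p.2)}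
  obtain ⟨u, hu, hdisj, hcover⟩ :=
    Vitali.exists_disjoint_subfamily_covering_enlargement_closedBall good Prod.fst Prod.snd η
      (fun p hp => hp.2.1) 5 (by norm_num)
  have hmeas : ∀ p : u, MeasurableSet (Metric.closedBall p.1.1 p.1.2) :=
    fun _ => Metric.isClosed_closedBall.measurableSet
  have hdisj' : Pairwise (Function.onFun Disjoint
      fun p : u => Metric.closedBall p.1.1 p.1.2) :=
    fun p q hpq => hdisj p.2 q.2 (Subtype.coe_ne_coe.2 hpq)
  refine ⟨u, ?_, fun p hp => (hu hp).2.1, fun x hx => ?_, ?_⟩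
  · have hpos : {p : u | 0 < μ (Metric.closedBall p.1.1 p.1.2)} = Set.univ :=
      Set.eq_univ_of_forall fun p => lt_of_lt_of_le
        (ENNReal.rpow_pos (ENNReal.ofReal_pos.2 (hu p.2).1) ENNReal.ofReal_ne_top) (hu p.2).2.2
    have hcount := Measure.countable_meas_pos_of_disjoint_iUnion (μ := μ) hmeas hdisj'
    rwa [hpos, Set.countable_univ_iff, Set.countable_coe_iff] at hcount
  · obtain ⟨r, hr⟩ := hA x hx
    obtain ⟨p, hp, hsub⟩ := hcover (x, r) hr
    exact Set.mem_iUnion.2 ⟨⟨p, hp⟩, hsub (Metric.mem_closedBall_self hr.1.le)⟩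
  · calc ∑' p : u, ENNReal.ofReal p.1.2 ^ s
        ≤ ∑' p : u, μ (Metric.closedBall p.1.1 p.1.2) :=
          ENNReal.tsum_le_tsum fun p => (hu p.2).2.2
      _ ≤ μ Set.univ := tsum_measure_le_measure_univ
          (fun p => (hmeas p).nullMeasurableSet) (fun p q hpq => (hdisj' hpq).aedisjoint)

omit [MeasurableSpace X] [BorelSpace X] in
lemma ediam_closedBall_five_mul_le (x : X) (r : ℝ) :
    Metric.ediam (Metric.closedBall x (5 * r)) ≤ 10 * ENNReal.ofReal r := by
  rcases lt_or_ge r 0 with hr | hr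
  · simp [Metric.closedBall_eq_empty.2 (by linarith : 5 * r < 0)]
  · calc Metric.ediam (Metric.closedBall x (5 * r))
        = Metric.ediam (Metric.closedEBall x (ENNReal.ofReal (5 * r))) := by
          rw [Metric.closedEBall_ofReal (by positivity)]
      _ ≤ 2 * ENNReal.ofReal (5 * r) := Metric.ediam_closedEBall_le
      _ = 10 * ENNReal.ofReal r := by
          rw [ENNReal.ofReal_mul (by norm_num), ENNReal.ofReal_ofNat, ← mul_assoc]
          norm_num

lemma hausdorffMeasure_setOf_frequently_le_measure_closedBall (μ : Measure X) [SFinite μ]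
    {s : ℝ} (hs : 0 ≤ s) :
    μH[s] {x | ∃ᶠ r in 𝓝[>] (0 : ℝ), ENNReal.ofReal r ^ s ≤ μ (Metric.closedBall x r)} ≤
      10 ^ s * μ Set.univ := by
  set A : Set X := {x | ∃ᶠ r in 𝓝[>] (0 : ℝ), ENNReal.ofReal r ^ s ≤ μ (Metric.closedBall x r)}
  have hA : ∀ n : ℕ, ∀ x ∈ A, ∃ r, 0 < r ∧ r ≤ 1 / ((n : ℝ) + 1) ∧
      ENNReal.ofReal r ^ s ≤ μ (Metric.closedBall x r) := fun n x hx => by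
    obtain ⟨r, hr, hr0, hrn⟩ :=
      (Frequently.and_eventually hx (Ioc_mem_nhdsGT (Nat.one_div_pos_of_nat (n := n)))).exists
    exact ⟨r, hr0, hrn, hr⟩
  choose u hcount hradius hcover hsum using fun n => exists_countable_cover_closedBall (hA n)
  have := fun n => (hcount n).to_subtype
  have hlim : Tendsto (fun n : ℕ => 10 * ENNReal.ofReal (1 / ((n : ℝ) + 1))) atTop (𝓝 0) := by
    simpa using ENNReal.Tendsto.const_mul (a := 10)
      (ENNReal.tendsto_ofReal tendsto_one_div_add_atTop_nhds_zero_nat) (by simp)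
  have hsum_diam : ∀ n, ∑' p : u n, Metric.ediam (Metric.closedBall p.1.1 (5 * p.1.2)) ^ s ≤
      10 ^ s * μ Set.univ := fun n => by
    calc ∑' p : u n, Metric.ediam (Metric.closedBall p.1.1 (5 * p.1.2)) ^ s
        ≤ ∑' p : u n, 10 ^ s * ENNReal.ofReal p.1.2 ^ s := ENNReal.tsum_le_tsum fun p => by
          rw [← ENNReal.mul_rpow_of_nonneg _ _ hs]
          exact ENNReal.rpow_le_rpow (ediam_closedBall_five_mul_le _ _) hs
      _ = 10 ^ s * ∑' p : u n, ENNReal.ofReal p.1.2 ^ s := ENNReal.tsum_mul_left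
      _ ≤ 10 ^ s * μ Set.univ := by gcongr; exact hsum n
  refine (Measure.hausdorffMeasure_le_liminf_tsum s A _ hlim
    (fun n (p : u n) => Metric.closedBall p.1.1 (5 * p.1.2))
    (.of_forall fun n p => ?_) (.of_forall hcover)).trans
    (liminf_le_of_le (by isBoundedDefault) fun b hb => ?_)
  · exact (ediam_closedBall_five_mul_le _ _).trans (by gcongr; exact hradius n _ p.2)
  · obtain ⟨n, hn⟩ := hb.exists
    exact hn.trans (hsum_diam n)

theorem dimH_setOf_frequently_le_measure_closedBall (μ : Measure X) [IsFiniteMeasure μ] (s : ℝ≥0) :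
    dimH {x | ∃ᶠ r in 𝓝[>] (0 : ℝ), ENNReal.ofReal r ^ (s : ℝ) ≤ μ (Metric.closedBall x r)} ≤ s :=
  dimH_le_of_hausdorffMeasure_ne_top (ne_top_of_le_ne_top (by finiteness)
    (hausdorffMeasure_setOf_frequently_le_measure_closedBall μ s.coe_nonneg))

lemma dimH_unitAddCircle_le (A : Set UnitAddCircle) : dimH A ≤ 1 := by
  refine (dimH_mono fun x _ => Eventually.frequently ?_).trans
    (dimH_setOf_frequently_le_measure_closedBall (volume : Measure UnitAddCircle) 1)
  filter_upwards [Ioc_mem_nhdsGT (one_half_pos (α := ℝ))] with r hr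
  rw [NNReal.coe_one, ENNReal.rpow_one, AddCircle.volume_closedBall]
  exact ENNReal.ofReal_le_ofReal (le_min (by linarith [hr.2]) (by linarith [hr.1]))

lemma exists_inv_two_pow_succ_lt_le {d : ℝ≥0∞} (hd : d ≠ 0) (hd1 : d ≤ 1) :
    ∃ n : ℕ, (2 ^ (n + 1))⁻¹ < d ∧ d ≤ (2 ^ n)⁻¹ := by
  lift d to ℝ≥0 using ne_top_of_le_ne_top ENNReal.one_ne_top hd1
  obtain ⟨n, hn, hn'⟩ := exists_nat_pow_near_of_lt_one (pos_iff_ne_zero.2 (mod_cast hd))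
    (mod_cast hd1 : d ≤ 1) (y := (2 : ℝ≥0)⁻¹) (by positivity)
    (inv_lt_one_of_one_lt₀ one_lt_two)
  have hcoe : ∀ k : ℕ, ((2 ^ k)⁻¹ : ℝ≥0∞) = ((2⁻¹ ^ k : ℝ≥0) : ℝ≥0∞) := fun k => by
    rw [inv_pow, ENNReal.coe_inv (by positivity), ENNReal.coe_pow, ENNReal.coe_ofNat]
  exact ⟨n, by rw [hcoe]; exact_mod_cast hn, by rw [hcoe]; exact_mod_cast hn'⟩

lemma tendsto_inv_two_pow_rpow {s : ℝ} (hs : 0 < s) :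
    Tendsto (fun n : ℕ => ((2 ^ n)⁻¹ : ℝ≥0∞) ^ s) atTop (𝓝 0) := by
  have h : Tendsto (fun n : ℕ => ((2 ^ n)⁻¹ : ℝ≥0∞)) atTop (𝓝 0) := by
    simpa only [ENNReal.inv_pow] using
      ENNReal.tendsto_pow_atTop_nhds_zero_of_lt_one (r := 2⁻¹) (by simp)
  simpa only [ENNReal.zero_rpow_of_pos hs] using h.ennrpow_const s

lemma le_hausdorffMeasure_of_dyadic {ν : Measure X} {s : ℝ} (hs : 0 < s)
    (h : ∀ᶠ n : ℕ in atTop, ∀ S : Set X, Metric.ediam S ≤ (2 ^ n)⁻¹ →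
      ν S ≤ ((2 ^ (n + 1))⁻¹) ^ s) : ν ≤ μH[s] := by
  obtain ⟨n₀, hn₀⟩ := eventually_atTop.1 h
  refine Measure.le_hausdorffMeasure s ν ((2 ^ (n₀ + 1))⁻¹) (by simp) fun S hS => ?_
  have hS₀ : Metric.ediam S ≤ (2 ^ n₀)⁻¹ :=
    hS.trans (ENNReal.inv_le_inv.2 (pow_le_pow_right₀ one_le_two n₀.le_succ))
  rcases eq_or_ne (Metric.ediam S) 0 with h0 | h0
  · refine ge_of_tendsto' ((tendsto_inv_two_pow_rpow hs).comp (tendsto_add_atTop_nat (n₀ + 1)))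
      (fun n => ?_) |>.trans zero_le
    exact hn₀ (n + n₀) (by omega) S (by simp [h0])
  · obtain ⟨n, hn, hn'⟩ := exists_inv_two_pow_succ_lt_le h0
      (hS₀.trans (ENNReal.inv_le_one.2 (one_le_pow₀ one_le_two)))
    have hlt : (2 : ℝ≥0∞) ^ (n₀ + 1) < 2 ^ (n + 1) := ENNReal.inv_lt_inv.1 (hn.trans_le hS)
    have hle : n₀ ≤ n := by
      by_contra! hlt'
      exact absurd (pow_le_pow_right₀ (a := (2 : ℝ≥0∞)) one_le_two (by omega)) hlt.not_ge
    exact (hn₀ n hle S hn').trans (ENNReal.rpow_le_rpow hn.le hs.le)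

lemma ofReal_le_dimH_of_ae_mem {ν : Measure X} (hν : ν ≠ 0) {d : ℝ} {A : Set X}
    (hac : ∀ s : ℝ, 0 < s → s < d → ν ≪ μH[s]) (hA : ∀ᵐ x ∂ν, x ∈ A) :
    ENNReal.ofReal d ≤ dimH A := by
  refine le_of_forall_lt fun s hs => ?_
  lift s to ℝ≥0 using hs.ne_top
  by_contra! hlt
  obtain ⟨s', hs', hs'd⟩ := ENNReal.lt_iff_exists_nnreal_btwn.1 hs
  have hzero : ν A = 0 :=
    hac s' (s.coe_nonneg.trans_lt (by exact_mod_cast hs'))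
      ((ENNReal.lt_ofReal_iff_toReal_lt ENNReal.coe_ne_top).1 hs'd)
      (hausdorffMeasure_of_dimH_lt (hlt.trans_lt hs'))
  rw [measure_eq_zero_iff_ae_notMem] at hzero
  have : (ae ν).NeBot := ae_neBot.2 hν
  obtain ⟨x, hx, hx'⟩ := (hA.and hzero).exists
  exact hx' hx

end Hausdorff

section DirichletKernel

lemma norm_fourier_apply (k : ℤ) (u : UnitAddCircle) : ‖fourier k u‖ = 1 := Circle.norm_coe _

lemma card_Icc_neg_natCast (n : ℕ) : (Finset.Icc (-(n : ℤ)) n).card = 2 * n + 1 := by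
  rw [Int.card_Icc]
  omega

/-- The Dirichlet kernel `D_n = ∑_{|k| ≤ n} e_k`, whose convolution with `f` is `S_n f`. -/
noncomputable def dirichletKernel (n : ℕ) (u : UnitAddCircle) : ℂ :=
  ∑ k ∈ Finset.Icc (-(n : ℤ)) (n : ℤ), fourier k u

lemma norm_dirichletKernel_le (n : ℕ) (u : UnitAddCircle) : ‖dirichletKernel n u‖ ≤ 2 * n + 1 := by
  refine (norm_sum_le _ _).trans_eq ?_
  simp only [norm_fourier_apply, Finset.sum_const, card_Icc_neg_natCast, nsmul_eq_mul, mul_one]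
  push_cast
  rfl

lemma dirichletKernel_mul_sub_one (n : ℕ) (u : UnitAddCircle) :
    dirichletKernel n u * (fourier 1 u - 1) = fourier (n + 1 : ℤ) u - fourier (-n : ℤ) u := by
  induction n with
  | zero => simp [dirichletKernel]
  | succ n ih =>
    have hsucc : dirichletKernel (n + 1) u =
        fourier (n + 1 : ℤ) u + fourier (-(n + 1) : ℤ) u + dirichletKernel n u := by
      simp only [dirichletKernel, Nat.cast_succ, Finset.sum_Icc_succ_eq_add_endpoints]
    have htop : fourier (n + 1 + 1 : ℤ) u = fourier (n + 1 : ℤ) u * fourier 1 u := fourier_add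
    have hbot : fourier (-n : ℤ) u = fourier (-(n + 1) : ℤ) u * fourier 1 u := by
      rw [← fourier_add, neg_add_rev, neg_add_cancel_comm]
    rw [hsucc, add_mul, ih, hbot, Nat.cast_succ, htop]
    ring

lemma four_mul_norm_le_norm_fourier_one_sub_one (u : UnitAddCircle) :
    4 * ‖u‖ ≤ ‖fourier 1 u - 1‖ := by
  obtain ⟨y, hy, rfl⟩ : ∃ y : ℝ, |y| ≤ 1 / 2 ∧ (y : UnitAddCircle) = u := by
    induction u using QuotientAddGroup.induction_on with | H x =>
    refine ⟨x - round x, abs_sub_round x, ?_⟩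
    rw [AddCircle.coe_sub, sub_eq_self]
    exact (AddCircle.coe_eq_zero_iff 1).2 ⟨round x, by simp⟩
  have hexp : fourier 1 (y : UnitAddCircle) =
      Complex.exp (Complex.I * ((2 * (Real.pi * y) : ℝ) : ℂ)) := by
    rw [fourier_coe_apply]
    congr 1
    push_cast
    ring
  have habs : |Real.pi * y| = Real.pi * |y| := by rw [abs_mul, abs_of_pos Real.pi_pos]
  have hsin : 2 * |y| ≤ |Real.sin (Real.pi * y)| := by
    have h := Real.mul_abs_le_abs_sin (x := Real.pi * y) (by rw [habs]; nlinarith [Real.pi_pos])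
    rwa [habs, ← mul_assoc, div_mul_cancel₀ _ Real.pi_ne_zero] at h
  rw [(AddCircle.norm_coe_eq_abs_iff 1 one_ne_zero).2 (by simpa using hy), hexp,
    Complex.norm_exp_I_mul_ofReal_sub_one, mul_div_cancel_left₀ _ two_ne_zero, norm_mul,
    Real.norm_eq_abs, Real.norm_eq_abs, abs_two]
  linarith

lemma norm_dirichletKernel_mul_norm_le (n : ℕ) (u : UnitAddCircle) :
    ‖dirichletKernel n u‖ * ‖u‖ ≤ 1 / 2 := by
  have h : ‖dirichletKernel n u‖ * ‖fourier 1 u - 1‖ ≤ 2 := by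
    rw [← norm_mul, dirichletKernel_mul_sub_one]
    refine (norm_sub_le _ _).trans ?_
    rw [norm_fourier_apply, norm_fourier_apply, one_add_one_eq_two]
  have := mul_le_mul_of_nonneg_left (four_mul_norm_le_norm_fourier_one_sub_one u)
    (norm_nonneg (dirichletKernel n u))
  linarith

lemma exists_norm_dirichletKernel_le {n K : ℕ} (hn : n < 2 ^ (K + 1)) (u : UnitAddCircle) :
    ∃ k ≤ K, ‖u‖ ≤ ((2 : ℝ) ^ k)⁻¹ ∧ ‖dirichletKernel n u‖ ≤ 2 ^ (k + 2) := by
  rcases le_or_gt ‖u‖ ((2 : ℝ) ^ K)⁻¹ with hK | hK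
  · refine ⟨K, le_rfl, hK, (norm_dirichletKernel_le n u).trans ?_⟩
    have : (n : ℝ) + 1 ≤ 2 ^ (K + 1) := by exact_mod_cast hn
    rw [pow_succ (2 : ℝ) (K + 1)]
    linarith
  · have hu0 : 0 < ‖u‖ := (by positivity : (0 : ℝ) < ((2 : ℝ) ^ K)⁻¹).trans hK
    have hu1 : ‖u‖ ≤ 1 := (AddCircle.norm_le_half_period 1 one_ne_zero).trans (by norm_num)
    obtain ⟨k, hk, hk'⟩ := exists_nat_pow_near_of_lt_one hu0 hu1 (y := (2 : ℝ)⁻¹)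
      (by norm_num) (by norm_num)
    rw [inv_pow] at hk hk'
    refine ⟨k, ?_, hk', ?_⟩
    · have : (2 : ℝ) ^ k < 2 ^ K :=
        (inv_lt_inv₀ (by positivity) (by positivity)).1 (hK.trans_le hk')
      exact ((pow_lt_pow_iff_right₀ one_lt_two).1 this).le
    · have h : ‖dirichletKernel n u‖ * ((2 : ℝ) ^ (k + 1))⁻¹ ≤ 1 / 2 :=
        (mul_le_mul_of_nonneg_left hk.le (norm_nonneg _)).trans
          (norm_dirichletKernel_mul_norm_le n u)
      rw [← div_eq_mul_inv, div_le_iff₀ (by positivity)] at h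
      exact h.trans (by rw [pow_succ, pow_add]; linarith [pow_pos (two_pos (α := ℝ)) k])

lemma norm_dirichletKernel_le_sum {n K : ℕ} (hn : n < 2 ^ (K + 1)) (u : UnitAddCircle) :
    ‖dirichletKernel n u‖ ≤ ∑ k ∈ Finset.range (K + 1),
      (2 : ℝ) ^ (k + 2) * (if ‖u‖ ≤ ((2 : ℝ) ^ k)⁻¹ then 1 else 0) := by
  obtain ⟨k, hk, hu, hD⟩ := exists_norm_dirichletKernel_le hn u
  calc ‖dirichletKernel n u‖
      ≤ (2 : ℝ) ^ (k + 2) * (if ‖u‖ ≤ ((2 : ℝ) ^ k)⁻¹ then 1 else 0) := by simpa [hu] using hD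
    _ ≤ _ := Finset.single_le_sum
        (f := fun k => (2 : ℝ) ^ (k + 2) * (if ‖u‖ ≤ ((2 : ℝ) ^ k)⁻¹ then 1 else 0))
        (fun _ _ => by positivity) (Finset.mem_range.2 (Nat.lt_succ_of_le hk))

end DirichletKernel

section UpperBound

variable {f : UnitAddCircle → ℂ}

lemma fourierPartialSum_eq_integral (hf : Integrable f AddCircle.haarAddCircle) (n : ℕ)
    (x : UnitAddCircle) :
    fourierPartialSum n f x = ∫ t, f t * dirichletKernel n (x - t) ∂AddCircle.haarAddCircle := by
  have hsub : ∀ (k : ℤ) (t : UnitAddCircle),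
      fourier k (x - t) = fourier (-k) t * fourier k x := fun k t => by
    have hk : k • (x - t) = -k • t + k • x := by rw [zsmul_sub, neg_zsmul, sub_eq_neg_add]
    rw [fourier_apply, fourier_apply, fourier_apply, hk, AddCircle.toCircle_add, Circle.coe_mul]
  have hker : ∀ t, f t * dirichletKernel n (x - t) =
      ∑ k ∈ Finset.Icc (-(n : ℤ)) (n : ℤ), (fourier (-k) t • f t) * fourier k x := fun t => by
    rw [dirichletKernel, Finset.mul_sum]
    refine Finset.sum_congr rfl fun k _ => ?_
    rw [hsub, smul_eq_mul]
    ring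
  simp_rw [hker]
  rw [integral_finsetSum _ fun k _ => (hf.fourier_smul (-k)).mul_const _]
  exact Finset.sum_congr rfl fun k _ => (integral_mul_const _ _).symm

/-- The measure `|f| dt` on the circle, whose mass near a point controls the partial sums of the
Fourier series of `f` there. -/
noncomputable def absMeasure (f : UnitAddCircle → ℂ) : Measure UnitAddCircle :=
  (AddCircle.haarAddCircle : Measure UnitAddCircle).withDensity fun t => ‖f t‖ₑ

lemma isFiniteMeasure_absMeasure (hf : Integrable f AddCircle.haarAddCircle) :
    IsFiniteMeasure (absMeasure f) :=
  isFiniteMeasure_withDensity hf.2.ne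

lemma norm_fourierPartialSum_le_sum (hf : Integrable f AddCircle.haarAddCircle) {n K : ℕ}
    (hn : n < 2 ^ (K + 1)) (x : UnitAddCircle) :
    ‖fourierPartialSum n f x‖ ≤ ∑ k ∈ Finset.range (K + 1),
      (2 : ℝ) ^ (k + 2) * (absMeasure f).real (Metric.closedBall x ((2 : ℝ) ^ k)⁻¹) := by
  have hmeas : ∀ k : ℕ, MeasurableSet (Metric.closedBall x ((2 : ℝ) ^ k)⁻¹) := fun _ =>
    Metric.isClosed_closedBall.measurableSet
  have hball : ∀ k : ℕ, (absMeasure f).real (Metric.closedBall x ((2 : ℝ) ^ k)⁻¹) =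
      ∫ t, (Metric.closedBall x ((2 : ℝ) ^ k)⁻¹).indicator (fun t => ‖f t‖) t
        ∂AddCircle.haarAddCircle := fun k => by
    rw [integral_indicator (hmeas k), Measure.real, absMeasure, withDensity_apply _ (hmeas k),
      integral_norm_eq_lintegral_enorm hf.1.restrict]
  have hint : ∀ k ∈ Finset.range (K + 1), Integrable (fun t => (2 : ℝ) ^ (k + 2) *
      (Metric.closedBall x ((2 : ℝ) ^ k)⁻¹).indicator (fun t => ‖f t‖) t)
        (AddCircle.haarAddCircle : Measure UnitAddCircle) := fun k _ =>
    (hf.norm.indicator (hmeas k)).const_mul _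
  simp_rw [hball, ← integral_const_mul]
  rw [fourierPartialSum_eq_integral hf, ← integral_finsetSum _ hint]
  refine norm_integral_le_of_norm_le (integrable_finsetSum _ hint) (.of_forall fun t => ?_)
  calc ‖f t * dirichletKernel n (x - t)‖
      ≤ ‖f t‖ * ∑ k ∈ Finset.range (K + 1),
          (2 : ℝ) ^ (k + 2) * (if ‖x - t‖ ≤ ((2 : ℝ) ^ k)⁻¹ then 1 else 0) := by
        rw [norm_mul]
        gcongr
        exact norm_dirichletKernel_le_sum hn (x - t)
    _ = ∑ k ∈ Finset.range (K + 1), (2 : ℝ) ^ (k + 2) *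
          (Metric.closedBall x ((2 : ℝ) ^ k)⁻¹).indicator (fun t => ‖f t‖) t := by
        rw [Finset.mul_sum]
        refine Finset.sum_congr rfl fun k _ => ?_
        simp only [Set.indicator, Metric.mem_closedBall, dist_comm t x, dist_eq_norm]
        split_ifs <;> ring

lemma norm_fourierPartialSum_le_rpow (hf : Integrable f AddCircle.haarAddCircle) {s C : ℝ}
    (hs : s < 1) {x : UnitAddCircle}
    (hC : ∀ k : ℕ, (absMeasure f).real (Metric.closedBall x ((2 : ℝ) ^ k)⁻¹) ≤
      C * (((2 : ℝ) ^ k)⁻¹) ^ s) {n : ℕ} (hn : n ≠ 0) :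
    ‖fourierPartialSum n f x‖ ≤
      4 * C * ((2 : ℝ) ^ (1 - s) / (2 ^ (1 - s) - 1)) * (n : ℝ) ^ (1 - s) := by
  set ρ : ℝ := (2 : ℝ) ^ (1 - s)
  have hρ1 : 0 < ρ - 1 := sub_pos.2 (Real.one_lt_rpow one_lt_two (sub_pos.2 hs))
  have hC0 : 0 ≤ C := by simpa using measureReal_nonneg.trans (hC 0)
  have hpow : ∀ k : ℕ, ρ ^ k = ((2 : ℝ) ^ k) ^ (1 - s) := fun k =>
    Real.rpow_pow_comm zero_le_two _ _
  have hterm : ∀ k : ℕ, (2 : ℝ) ^ (k + 2) *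
      (absMeasure f).real (Metric.closedBall x ((2 : ℝ) ^ k)⁻¹) ≤ 4 * C * ρ ^ k := fun k => by
    calc _ ≤ (2 : ℝ) ^ (k + 2) * (C * (((2 : ℝ) ^ k)⁻¹) ^ s) := by gcongr; exact hC k
      _ = 4 * C * ρ ^ k := by
        rw [hpow, Real.rpow_sub (by positivity), Real.rpow_one, Real.inv_rpow (by positivity)]
        ring
  set K := Nat.log 2 n
  calc ‖fourierPartialSum n f x‖
      ≤ ∑ k ∈ Finset.range (K + 1), (2 : ℝ) ^ (k + 2) *
          (absMeasure f).real (Metric.closedBall x ((2 : ℝ) ^ k)⁻¹) :=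
        norm_fourierPartialSum_le_sum hf (Nat.lt_pow_succ_log_self one_lt_two n) x
    _ ≤ ∑ k ∈ Finset.range (K + 1), 4 * C * ρ ^ k := Finset.sum_le_sum fun k _ => hterm k
    _ = 4 * C * ((ρ ^ (K + 1) - 1) / (ρ - 1)) := by
      rw [← Finset.mul_sum, geom_sum_eq (sub_pos.1 hρ1).ne']
    _ ≤ 4 * C * (ρ ^ (K + 1) / (ρ - 1)) := by
      gcongr
      exact sub_le_self _ zero_le_one
    _ = 4 * C * (ρ / (ρ - 1)) * ρ ^ K := by ring
    _ ≤ 4 * C * (ρ / (ρ - 1)) * (n : ℝ) ^ (1 - s) := by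
      rw [hpow]
      gcongr
      exact_mod_cast Nat.pow_log_le_self 2 hn

open Asymptotics in
lemma isBigO_fourierPartialSum (hf : Integrable f AddCircle.haarAddCircle) {s : ℝ} (hs : s < 1)
    {x : UnitAddCircle}
    (hx : (fun k : ℕ => (absMeasure f).real (Metric.closedBall x ((2 : ℝ) ^ k)⁻¹)) =O[atTop]
      fun k : ℕ => (((2 : ℝ) ^ k)⁻¹) ^ s) :
    (fun n => fourierPartialSum n f x) =O[atTop] fun n : ℕ => (n : ℝ) ^ (1 - s) := by
  obtain ⟨C, -, hC⟩ := bound_of_isBigO_nat_atTop hx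
  have hpos : ∀ k : ℕ, 0 < (((2 : ℝ) ^ k)⁻¹) ^ s := fun k => by positivity
  refine IsBigO.of_bound (4 * C * ((2 : ℝ) ^ (1 - s) / (2 ^ (1 - s) - 1))) ?_
  filter_upwards [eventually_ne_atTop 0] with n hn
  rw [Real.norm_of_nonneg (by positivity : 0 ≤ (n : ℝ) ^ (1 - s))]
  refine norm_fourierPartialSum_le_rpow hf hs (fun k => ?_) hn
  simpa only [Real.norm_of_nonneg measureReal_nonneg, Real.norm_of_nonneg (hpos k).le]
    using hC (hpos k).ne'

/-- The set of points at which the partial sums of the Fourier series of `f` exceed `n ^ γ`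
infinitely often; the sets `divergenceLevelSet β f` are squeezed between such sets. -/
def fastGrowthSet (γ : ℝ) (f : UnitAddCircle → ℂ) : Set UnitAddCircle :=
  {x | ∃ᶠ n : ℕ in atTop, (n : ℝ) ^ γ ≤ ‖fourierPartialSum n f x‖}

lemma frequently_le_absMeasure_closedBall (hf : Integrable f AddCircle.haarAddCircle) {s γ : ℝ}
    (hs : s < 1) (hγ : 1 - γ < s) {x : UnitAddCircle} (hx : x ∈ fastGrowthSet γ f) :
    ∃ᶠ r in 𝓝[>] (0 : ℝ), ENNReal.ofReal r ^ s ≤ absMeasure f (Metric.closedBall x r) := by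
  have := isFiniteMeasure_absMeasure hf
  by_contra hcon
  have hradius : Tendsto (fun k : ℕ => ((2 : ℝ) ^ k)⁻¹) atTop (𝓝[>] 0) := by
    simpa only [inv_pow] using tendsto_pow_atTop_nhdsWithin_zero_of_lt_one
      (show (0 : ℝ) < 2⁻¹ by norm_num) (by norm_num)
  have hsmall : (fun k : ℕ => (absMeasure f).real (Metric.closedBall x ((2 : ℝ) ^ k)⁻¹)) =O[atTop]
      fun k : ℕ => (((2 : ℝ) ^ k)⁻¹) ^ s := by
    refine Asymptotics.IsBigO.of_bound 1 ?_
    filter_upwards [hradius.eventually (not_frequently.1 hcon)] with k hk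
    rw [not_le, ENNReal.ofReal_rpow_of_pos (by positivity)] at hk
    rw [one_mul, Real.norm_of_nonneg measureReal_nonneg, Real.norm_of_nonneg (by positivity)]
    exact ENNReal.toReal_le_of_le_ofReal (by positivity) hk.le
  obtain ⟨C, hC⟩ := (isBigO_fourierPartialSum hf hs hsmall).bound
  have hgrowth : Tendsto (fun n : ℕ => (n : ℝ) ^ (γ - (1 - s))) atTop atTop :=
    (tendsto_rpow_atTop (by linarith)).comp tendsto_natCast_atTop_atTop
  obtain ⟨n, hn, hnC, hlt, hn0⟩ := (Frequently.and_eventually hx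
    (hC.and ((hgrowth.eventually_gt_atTop C).and (eventually_gt_atTop 0)))).exists
  have hn0' : (0 : ℝ) < n := Nat.cast_pos.2 hn0
  have hpos := Real.rpow_pos_of_pos hn0' (1 - s)
  rw [Real.rpow_sub hn0', lt_div_iff₀ hpos] at hlt
  rw [Real.norm_of_nonneg hpos.le] at hnC
  exact (hlt.trans_le hn).not_ge hnC

theorem dimH_fastGrowthSet_le (hf : Integrable f AddCircle.haarAddCircle) {γ : ℝ} (hγ : 0 < γ) :
    dimH (fastGrowthSet γ f) ≤ ENNReal.ofReal (1 - γ) := by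
  have := isFiniteMeasure_absMeasure hf
  have hγ1 : ENNReal.ofReal (1 - γ) < 1 := ENNReal.ofReal_lt_one.2 (by linarith)
  refine le_of_forall_gt_imp_ge_of_dense fun d hd => ?_
  obtain ⟨s, hs, hsd⟩ := ENNReal.lt_iff_exists_nnreal_btwn.1 (lt_min hd hγ1)
  have hs1 : (s : ℝ) < 1 := by exact_mod_cast hsd.trans_le (min_le_right _ _)
  have hsγ : 1 - γ < s := by
    rw [← ENNReal.ofReal_coe_nnreal, ENNReal.ofReal_lt_ofReal_iff'] at hs
    exact hs.1
  calc dimH (fastGrowthSet γ f)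
      ≤ dimH {x | ∃ᶠ r in 𝓝[>] (0 : ℝ),
          ENNReal.ofReal r ^ (s : ℝ) ≤ absMeasure f (Metric.closedBall x r)} :=
        dimH_mono fun x hx => frequently_le_absMeasure_closedBall hf hs1 hsγ hx
    _ ≤ s := dimH_setOf_frequently_le_measure_closedBall _ s
    _ ≤ d := hsd.le.trans (min_le_left _ _)

lemma fastGrowthSet_anti : Antitone fun γ => fastGrowthSet γ f := fun γ γ' h x hx =>
  (Frequently.and_eventually hx (eventually_ge_atTop 1)).mono fun _ hn =>
    (Real.rpow_le_rpow_of_exponent_le (by exact_mod_cast hn.2) h).trans hn.1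

lemma le_log_enorm_div_log_iff {n : ℕ} (hn : 2 ≤ n) (γ : ℝ) (z : ℂ) :
    (γ : EReal) ≤ ENNReal.log ‖z‖ₑ / ((Real.log n : ℝ) : EReal) ↔ (n : ℝ) ^ γ ≤ ‖z‖ := by
  have hn1 : (1 : ℝ) < n := by exact_mod_cast hn
  have hn0 : (0 : ℝ) < n := by linarith
  rw [EReal.le_div_iff_mul_le (by exact_mod_cast Real.log_pos hn1) (EReal.coe_ne_top _),
    ← EReal.coe_mul, ← Real.log_rpow hn0,
    ← ENNReal.log_ofReal_of_pos (Real.rpow_pos_of_pos hn0 _), ENNReal.log_le_log_iff,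
    ← ofReal_norm, ENNReal.ofReal_le_ofReal_iff (norm_nonneg _)]

/-- The upper growth exponent of the partial sums of the Fourier series of `f` at `x`, so that
`divergenceLevelSet β f` is the set where it equals `β`. -/
noncomputable def growthExponent (f : UnitAddCircle → ℂ) (x : UnitAddCircle) : EReal :=
  limsup (fun n : ℕ => ENNReal.log ‖fourierPartialSum n f x‖ₑ / ((Real.log n : ℝ) : EReal)) atTop

lemma mem_fastGrowthSet_of_lt_growthExponent {x : UnitAddCircle} {γ : ℝ}
    (h : (γ : EReal) < growthExponent f x) : x ∈ fastGrowthSet γ f :=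
  ((frequently_lt_of_lt_limsup (by isBoundedDefault) h).and_eventually
    (eventually_ge_atTop 2)).mono fun _ hn => (le_log_enorm_div_log_iff hn.2 _ _).1 hn.1.le

lemma le_growthExponent_of_mem_fastGrowthSet {x : UnitAddCircle} {γ : ℝ}
    (h : x ∈ fastGrowthSet γ f) : (γ : EReal) ≤ growthExponent f x :=
  le_limsup_of_frequently_le ((Frequently.and_eventually h (eventually_ge_atTop 2)).mono
    fun _ hn => (le_log_enorm_div_log_iff hn.2 _ _).2 hn.1) (by isBoundedDefault)

theorem dimH_divergenceLevelSet_le (hf : Integrable f AddCircle.haarAddCircle) {β : ℝ}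
    (hβ : 0 ≤ β) : dimH (divergenceLevelSet β f) ≤ ENNReal.ofReal (1 - β) := by
  rcases hβ.eq_or_lt with rfl | hpos
  · simpa using dimH_unitAddCircle_le _
  have hlim : Tendsto (fun γ : ℝ => ENNReal.ofReal (1 - γ)) (𝓝[<] β) (𝓝 (ENNReal.ofReal (1 - β))) :=
    ((ENNReal.continuous_ofReal.comp (continuous_sub_left 1)).tendsto β).mono_left
      nhdsWithin_le_nhds
  refine ge_of_tendsto hlim ?_
  filter_upwards [Ioo_mem_nhdsLT hpos] with γ hγ
  refine (dimH_mono fun x (hx : growthExponent f x = β) => ?_).trans (dimH_fastGrowthSet_le hf hγ.1)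
  exact mem_fastGrowthSet_of_lt_growthExponent (hx ▸ EReal.coe_lt_coe_iff.2 hγ.2)

end UpperBound

section DigitMap

variable (P : ℕ → Prop) [DecidablePred P]

/-- Spread the binary digits of an integer over the positions `< n` satisfying `P`, and put zeros at
the other positions. Position `0` is the most significant one. -/
def insertDigits : ℕ → ℕ → ℕ
  | 0, a => a
  | n + 1, a => if P n then 2 * insertDigits n (a / 2) + a % 2 else 2 * insertDigits n a

lemma insertDigits_strictMono (n : ℕ) : StrictMono (insertDigits P n) := by
  induction n with
  | zero => exact strictMono_id
  | succ n ih =>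
    intro a b hab
    simp only [insertDigits]
    split_ifs
    · rcases (Nat.div_le_div_right hab.le : a / 2 ≤ b / 2).lt_or_eq with h | h
      · have := ih h
        have := Nat.mod_lt a two_pos
        omega
      · rw [h]
        omega
    · have := ih hab
      omega

/-- The integer formed by the first `n` binary digits of the image of `t` under `digitMap`. -/
noncomputable def digitApprox (n : ℕ) (t : ℝ) : ℕ :=
  insertDigits P n ⌊(2 : ℝ) ^ (Nat.count P n) * t⌋₊

/-- The map spreading the binary digits of `t ∈ [0, 1)` over the positions satisfying `P`; position
`n` carries the weight `2⁻ⁿ⁻¹`. -/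
noncomputable def digitMap (t : ℝ) : ℝ := ⨆ n, (digitApprox P n t : ℝ) / 2 ^ n

variable {P}

lemma digitApprox_succ_of_not {n : ℕ} (h : ¬ P n) (t : ℝ) :
    digitApprox P (n + 1) t = 2 * digitApprox P n t := by
  simp [digitApprox, insertDigits, h, Nat.count_succ]

lemma digitApprox_succ_mem_Icc (n : ℕ) (t : ℝ) :
    digitApprox P (n + 1) t ∈ Set.Icc (2 * digitApprox P n t) (2 * digitApprox P n t + 1) := by
  by_cases h : P n
  · have hfloor : ⌊(2 : ℝ) ^ (Nat.count P n + 1) * t⌋₊ / 2 = ⌊(2 : ℝ) ^ (Nat.count P n) * t⌋₊ := by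
      rw [← Nat.floor_div_ofNat, pow_succ, mul_right_comm, mul_div_assoc, div_self two_ne_zero,
        mul_one]
    simp only [digitApprox, insertDigits, h, if_true, Nat.count_succ, hfloor, Set.mem_Icc]
    have := Nat.mod_lt ⌊(2 : ℝ) ^ (Nat.count P n + 1) * t⌋₊ two_pos
    omega
  · simp [digitApprox_succ_of_not h]

lemma monotone_digitApprox_div (t : ℝ) : Monotone fun n => (digitApprox P n t : ℝ) / 2 ^ n := by
  refine monotone_nat_of_le_succ fun n => ?_
  have h : (2 : ℝ) * digitApprox P n t ≤ digitApprox P (n + 1) t := by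
    exact_mod_cast (digitApprox_succ_mem_Icc n t).1
  rw [pow_succ', ← mul_div_mul_left _ _ (two_ne_zero (α := ℝ))]
  gcongr

lemma antitone_digitApprox_add_one_div (t : ℝ) :
    Antitone fun n => ((digitApprox P n t : ℝ) + 1) / 2 ^ n := by
  refine antitone_nat_of_succ_le fun n => ?_
  have h : (digitApprox P (n + 1) t : ℝ) ≤ 2 * digitApprox P n t + 1 := by
    exact_mod_cast (digitApprox_succ_mem_Icc n t).2
  rw [pow_succ', ← mul_div_mul_left ((digitApprox P n t : ℝ) + 1) _ (two_ne_zero (α := ℝ))]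
  gcongr
  linarith

lemma digitApprox_div_le_add_one_div (n k : ℕ) (t : ℝ) :
    (digitApprox P k t : ℝ) / 2 ^ k ≤ ((digitApprox P n t : ℝ) + 1) / 2 ^ n := by
  have hstep : ∀ i, (digitApprox P i t : ℝ) / 2 ^ i ≤ ((digitApprox P i t : ℝ) + 1) / 2 ^ i :=
    fun i => by gcongr; exact le_add_of_nonneg_right zero_le_one
  rcases le_total k n with h | h
  · exact (monotone_digitApprox_div t h).trans (hstep n)
  · exact (hstep k).trans (antitone_digitApprox_add_one_div t h)

lemma digitMap_le (n : ℕ) (t : ℝ) : digitMap P t ≤ ((digitApprox P n t : ℝ) + 1) / 2 ^ n :=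
  ciSup_le fun k => digitApprox_div_le_add_one_div n k t

lemma le_digitMap (n : ℕ) (t : ℝ) : (digitApprox P n t : ℝ) / 2 ^ n ≤ digitMap P t :=
  le_ciSup (f := fun k => (digitApprox P k t : ℝ) / 2 ^ k)
    ⟨_, by rintro _ ⟨k, rfl⟩; exact digitApprox_div_le_add_one_div 0 k t⟩ n

lemma monotone_digitMap : Monotone (digitMap P) := fun t u htu => by
  refine ciSup_le fun n => le_trans ?_ (le_digitMap n u)
  have : digitApprox P n t ≤ digitApprox P n u :=
    (insertDigits_strictMono P n).monotone (Nat.floor_mono (by gcongr))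
  gcongr

lemma digitMap_nonneg (t : ℝ) : 0 ≤ digitMap P t := le_trans (by positivity) (le_digitMap 0 t)

lemma digitMap_le_half (h0 : ¬ P 0) {t : ℝ} (ht : t < 1) : digitMap P t ≤ 1 / 2 := by
  have h := digitMap_le (P := P) 1 t
  rw [digitApprox_succ_of_not h0] at h
  have : digitApprox P 0 t = 0 := by
    simpa [digitApprox, insertDigits] using ht
  simpa [this] using h

lemma digitApprox_div_eq_of_gap {a b : ℕ} (hab : a ≤ b) (h : ∀ i, a ≤ i → i < b → ¬ P i) (t : ℝ) :
    (digitApprox P b t : ℝ) / 2 ^ b = (digitApprox P a t : ℝ) / 2 ^ a := by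
  induction b, hab using Nat.le_induction with
  | base => rfl
  | succ b hb ih =>
    rw [← ih fun i hi hib => h i hi (by omega), digitApprox_succ_of_not (h b hb (by omega)),
      pow_succ', Nat.cast_mul, Nat.cast_ofNat, mul_div_mul_left _ _ two_ne_zero]

lemma digitMap_sub_le_of_gap {a b : ℕ} (hab : a ≤ b) (h : ∀ i, a ≤ i → i < b → ¬ P i) (t : ℝ) :
    digitMap P t - (digitApprox P a t : ℝ) / 2 ^ a ≤ ((2 : ℝ) ^ b)⁻¹ := by
  rw [sub_le_iff_le_add', ← digitApprox_div_eq_of_gap hab h, ← one_div, ← add_div]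
  exact digitMap_le b t

lemma sub_lt_of_digitMap_sub_le {n : ℕ} {t u : ℝ} (ht : 0 ≤ t)
    (h : digitMap P u - digitMap P t ≤ ((2 : ℝ) ^ n)⁻¹) :
    u - t < 3 * ((2 : ℝ) ^ (Nat.count P n))⁻¹ := by
  by_contra! hcon
  set q := Nat.count P n
  have hfloor : 3 + ⌊(2 : ℝ) ^ q * t⌋₊ ≤ ⌊(2 : ℝ) ^ q * u⌋₊ := by
    rw [← div_eq_mul_inv, div_le_iff₀ (by positivity)] at hcon
    apply Nat.le_floor
    push_cast
    linarith [Nat.floor_le (show 0 ≤ (2 : ℝ) ^ q * t by positivity)]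
  have happrox : 3 + digitApprox P n t ≤ digitApprox P n u :=
    ((insertDigits_strictMono P n).add_le_nat 3 _).trans
      ((insertDigits_strictMono P n).monotone hfloor)
  have hdiv : (3 + digitApprox P n t : ℝ) / 2 ^ n ≤ digitApprox P n u / 2 ^ n := by
    gcongr
    exact_mod_cast happrox
  have hpos : 0 < ((2 : ℝ) ^ n)⁻¹ := by positivity
  have ht' := digitMap_le (P := P) n t
  have hu' := le_digitMap (P := P) n u
  rw [add_div, div_eq_mul_inv 3] at hdiv
  rw [add_div, one_div] at ht'
  linarith

end DigitMap

section DigitMeasure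

/-- The image on the circle of Lebesgue measure on `[0, 1)` under `digitMap P`: the uniform measure
on the Cantor set of points whose binary digits vanish at the positions not satisfying `P`. -/
noncomputable def digitMeasure (P : ℕ → Prop) [DecidablePred P] : Measure UnitAddCircle :=
  (volume.restrict (Set.Ico (0 : ℝ) 1)).map fun t => (digitMap P t : UnitAddCircle)

variable {P : ℕ → Prop} [DecidablePred P]

lemma measurable_coe_digitMap : Measurable fun t => (digitMap P t : UnitAddCircle) :=
  (AddCircle.continuous_mk' 1).measurable.comp monotone_digitMap.measurable

lemma digitMeasure_ne_zero : digitMeasure P ≠ 0 := by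
  rw [digitMeasure, Ne, Measure.map_eq_zero_iff measurable_coe_digitMap.aemeasurable,
    Measure.restrict_eq_zero]
  simp

lemma edist_le_of_edist_coe_digitMap_le (h0 : ¬ P 0) {n : ℕ} {t u : ℝ}
    (ht : t ∈ Set.Ico (0 : ℝ) 1) (hu : u ∈ Set.Ico (0 : ℝ) 1)
    (h : edist (digitMap P t : UnitAddCircle) (digitMap P u) ≤ (2 ^ n)⁻¹) :
    edist t u ≤ 3 * (2 ^ Nat.count P n)⁻¹ := by
  have hofReal : ∀ k : ℕ, ((2 ^ k)⁻¹ : ℝ≥0∞) = ENNReal.ofReal ((2 ^ k)⁻¹) := fun k => by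
    rw [ENNReal.ofReal_inv_of_pos (by positivity), ENNReal.ofReal_pow zero_le_two,
      ENNReal.ofReal_ofNat]
  have hhalf : |digitMap P t - digitMap P u| ≤ |(1 : ℝ)| / 2 := by
    have := digitMap_nonneg (P := P) t
    have := digitMap_nonneg (P := P) u
    have := digitMap_le_half h0 ht.2
    have := digitMap_le_half h0 hu.2
    rw [abs_one, abs_le]
    constructor <;> linarith
  rw [edist_dist, dist_eq_norm, ← AddCircle.coe_sub,
    (AddCircle.norm_coe_eq_abs_iff 1 one_ne_zero).2 hhalf, hofReal,
    ENNReal.ofReal_le_ofReal_iff (by positivity), abs_le] at h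
  rw [edist_dist, hofReal, ← ENNReal.ofReal_ofNat, ← ENNReal.ofReal_mul zero_le_three,
    Real.dist_eq]
  refine ENNReal.ofReal_le_ofReal (abs_le.2 ⟨?_, ?_⟩)
  · linarith [sub_lt_of_digitMap_sub_le (P := P) (n := n) (u := u) ht.1 (by linarith)]
  · exact (sub_lt_of_digitMap_sub_le hu.1 (by linarith)).le

lemma digitMeasure_le (h0 : ¬ P 0) {n : ℕ} {S : Set UnitAddCircle}
    (hS : Metric.ediam S ≤ (2 ^ n)⁻¹) : digitMeasure P S ≤ 3 * (2 ^ Nat.count P n)⁻¹ := by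
  rw [← Metric.ediam_closure] at hS
  refine (measure_mono subset_closure).trans ?_
  rw [digitMeasure, Measure.map_apply measurable_coe_digitMap isClosed_closure.measurableSet,
    Measure.restrict_apply (measurable_coe_digitMap isClosed_closure.measurableSet)]
  refine (Real.volume_le_diam _).trans (Metric.ediam_le fun t ht u hu => ?_)
  exact edist_le_of_edist_coe_digitMap_le h0 ht.2 hu.2
    ((Metric.edist_le_ediam_of_mem (s := closure S) ht.1 hu.1).trans hS)

lemma digitMeasure_le_hausdorffMeasure (h0 : ¬ P 0) {s s' : ℝ} (hs : 0 < s) (hss' : s < s')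
    (hP : ∀ᶠ n : ℕ in atTop, s' * n ≤ Nat.count P n) : digitMeasure P ≤ μH[s] := by
  have hlarge : ∀ᶠ n : ℕ in atTop, 2 + s ≤ (s' - s) * n :=
    (tendsto_natCast_atTop_atTop.const_mul_atTop (sub_pos.2 hss')).eventually_ge_atTop _
  refine le_hausdorffMeasure_of_dyadic hs ?_
  filter_upwards [hP, hlarge] with n hn hn' S hS
  have htwo : ∀ k : ℕ, ((2 ^ k)⁻¹ : ℝ≥0∞) = 2 ^ (-(k : ℝ)) := fun k => by
    rw [ENNReal.rpow_neg, ENNReal.rpow_natCast]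
  calc digitMeasure P S
      ≤ 3 * (2 ^ Nat.count P n)⁻¹ := digitMeasure_le h0 hS
    _ ≤ 2 ^ (2 : ℝ) * 2 ^ (-(Nat.count P n : ℝ)) := by
      rw [htwo]
      gcongr
      norm_num
    _ = 2 ^ (2 - (Nat.count P n : ℝ)) := by
      rw [← ENNReal.rpow_add _ _ two_ne_zero ENNReal.ofNat_ne_top, sub_eq_add_neg]
    _ ≤ 2 ^ (-((n + 1 : ℕ) : ℝ) * s) := by
      refine ENNReal.rpow_le_rpow_of_exponent_le one_le_two ?_
      push_cast
      linarith
    _ = (2 ^ (n + 1))⁻¹ ^ s := by rw [htwo, ENNReal.rpow_mul]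

end DigitMeasure

section OutsideGaps

lemma exists_le_lt_succ_of_strictMono {N : ℕ → ℕ} (hN : StrictMono N) {i₀ n : ℕ}
    (hn : N (i₀ + 1) ≤ n) : ∃ i ≥ i₀, N (i + 1) ≤ n ∧ n < N (i + 2) := by
  obtain ⟨j, hj, hjn⟩ : ∃ j, N j ≤ n ∧ n < N (j + 1) := by
    have hcover := iUnion_Ico_map_succ_eq_Ici (fun i => hN.monotone bot_le)
      (not_bddAbove_of_tendsto_atTop hN.tendsto_atTop)
    simpa using hcover.ge ((hN.monotone bot_le).trans hn : N ⊥ ≤ n)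
  have hij : i₀ + 1 < j + 1 := hN.lt_iff_lt.1 (hn.trans_lt hjn)
  obtain ⟨i, rfl⟩ := Nat.exists_eq_add_one.2 (show 0 < j by omega)
  exact ⟨i, by omega, hj, hjn⟩

/-- The positions lying outside of all the gaps `[N i, m i)`. Position `0` is excluded as well, so
that `digitMap` takes values in `[0, 1/2]`, which embeds isometrically into the circle. -/
def OutsideGaps (N m : ℕ → ℕ) (n : ℕ) : Prop := n ≠ 0 ∧ ∀ i, ¬ (N i ≤ n ∧ n < m i)

variable {N m : ℕ → ℕ} [DecidablePred (OutsideGaps N m)]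

lemma le_count_outsideGaps_add (hN : Monotone N) (hNm : ∀ i, N i ≤ m i)
    (hsep : ∀ i, m i ≤ N (i + 1)) {i n : ℕ} (hm : 0 < m i) (hn : n ≤ N (i + 2)) :
    n ≤ Nat.count (OutsideGaps N m) n + (m i + (min n (m (i + 1)) - N (i + 1))) := by
  have hsub : ({k ∈ Finset.range n | ¬ OutsideGaps N m k}) ⊆
      Finset.range (m i) ∪ Finset.Ico (N (i + 1)) (min n (m (i + 1))) := fun k hk => by
    obtain ⟨hkn, hk⟩ := Finset.mem_filter.1 hk
    rw [Finset.mem_range] at hkn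
    rw [Finset.mem_union, Finset.mem_range, Finset.mem_Ico]
    rcases eq_or_ne k 0 with rfl | hk0
    · exact .inl hm
    obtain ⟨l, hl, hl'⟩ : ∃ l, N l ≤ k ∧ k < m l := by
      by_contra! hcon
      exact hk ⟨hk0, fun l hl => (hcon l hl.1).not_gt hl.2⟩
    rcases lt_trichotomy l (i + 1) with hli | rfl | hli
    · rcases (Nat.lt_succ_iff.1 hli).eq_or_lt with rfl | hli'
      · exact .inl hl'
      · exact .inl (hl'.trans_le ((hsep l).trans ((hN hli').trans (hNm i))))
    · exact .inr ⟨hl, lt_min hkn hl'⟩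
    · exact absurd (hN (show i + 2 ≤ l from hli)) (by omega)
  have hcard := (Finset.card_le_card hsub).trans (Finset.card_union_le _ _)
  rw [Finset.card_range, Nat.card_Ico] at hcard
  have hsplit := Finset.card_filter_add_card_filter_not (s := Finset.range n) (OutsideGaps N m)
  rw [Finset.card_range, ← Nat.count_eq_card_filter_range] at hsplit
  omega

lemma eventually_mul_le_count_outsideGaps {s s' : ℝ} (hs : 0 ≤ s) (hss' : s < s')
    (hN : StrictMono N) (hNm : ∀ i, N i ≤ m i) (hsep : ∀ i, (i + 1) * m i ≤ N (i + 1))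
    (hratio : ∀ᶠ i in atTop, s' * m i ≤ N i) :
    ∀ᶠ n : ℕ in atTop, s * n ≤ Nat.count (OutsideGaps N m) n := by
  have hpos : ∀ᶠ i in atTop, 0 < m i := (eventually_gt_atTop 0).mono fun i hi =>
    hi.trans_le (hN.le_apply.trans (hNm i))
  have hsmall : ∀ᶠ i : ℕ in atTop, 1 ≤ (s' - s) * ((i : ℝ) + 1) :=
    ((tendsto_natCast_atTop_atTop.atTop_add tendsto_const_nhds).const_mul_atTop
      (sub_pos.2 hss')).eventually_ge_atTop 1
  obtain ⟨i₀, hi₀⟩ := eventually_atTop.1 (hpos.and (hratio.and hsmall))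
  filter_upwards [eventually_ge_atTop (N (i₀ + 1))] with n hn
  obtain ⟨i, hi, hin, hni⟩ := exists_le_lt_succ_of_strictMono hN hn
  obtain ⟨hmi, -, hi1⟩ := hi₀ i hi
  obtain ⟨hmi', hi2, -⟩ := hi₀ (i + 1) (by omega)
  have hfirst : (m i : ℝ) ≤ (s' - s) * n := by
    have : ((i : ℝ) + 1) * m i ≤ n := by exact_mod_cast (hsep i).trans hin
    nlinarith
  have hlast : ((min n (m (i + 1)) - N (i + 1) : ℕ) : ℝ) ≤ (1 - s') * n := by
    have hs'1 : s' ≤ 1 := by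
      have : (N (i + 1) : ℝ) ≤ m (i + 1) := by exact_mod_cast hNm (i + 1)
      have : (0 : ℝ) < m (i + 1) := by exact_mod_cast hmi'
      nlinarith
    rcases le_total (min n (m (i + 1))) (N (i + 1)) with h | h
    · rw [Nat.sub_eq_zero_of_le h, Nat.cast_zero]
      exact mul_nonneg (by linarith) n.cast_nonneg
    · have hpn : ((min n (m (i + 1)) : ℕ) : ℝ) ≤ n := by exact_mod_cast min_le_left _ _
      have hpm : ((min n (m (i + 1)) : ℕ) : ℝ) ≤ m (i + 1) := by exact_mod_cast min_le_right _ _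
      rw [Nat.cast_sub h]
      nlinarith
  have hcount : (n : ℝ) ≤ Nat.count (OutsideGaps N m) n +
      (m i + (min n (m (i + 1)) - N (i + 1) : ℕ)) := by
    exact_mod_cast le_count_outsideGaps_add hN.monotone hNm
      (fun k => (Nat.le_mul_of_pos_left _ k.succ_pos).trans (hsep k)) hmi hni.le
  linarith

end OutsideGaps

/-- The `k`-th Fourier coefficient as a continuous linear functional on `L¹(𝕋)`. -/
noncomputable def fourierCoeffCLM (k : ℤ) : L1Circle →L[ℂ] ℂ :=
  LinearMap.mkContinuous
    { toFun := fun f => fourierCoeff (f : UnitAddCircle → ℂ) k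
      map_add' := fun f g => by
        rw [fourierCoeff_congr_ae (Lp.coeFn_add f g),
          fourierCoeff.add (L1.integrable_coeFn f) (L1.integrable_coeFn g)]
        rfl
      map_smul' := fun c f => by
        rw [fourierCoeff_congr_ae (Lp.coeFn_smul c f), fourierCoeff.const_smul]
        rfl } 1 fun f => by
    rw [one_mul, L1.norm_eq_integral_norm]
    refine (norm_integral_le_integral_norm _).trans_eq (integral_congr_ae (.of_forall fun t => ?_))
    beta_reduce
    rw [norm_smul, norm_fourier_apply, one_mul]

lemma fourierCoeffCLM_apply (k : ℤ) (f : L1Circle) :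
    fourierCoeffCLM k f = fourierCoeff (f : UnitAddCircle → ℂ) k := rfl

lemma norm_fourierCoeffCLM_apply_le (k : ℤ) (f : L1Circle) : ‖fourierCoeffCLM k f‖ ≤ ‖f‖ :=
  ((fourierCoeffCLM k).le_of_opNorm_le (LinearMap.mkContinuous_norm_le _ zero_le_one _) f).trans_eq
    (one_mul _)

/-- Evaluation at `x` of the `n`-th partial sum of the Fourier series. -/
noncomputable def partialSumCLM (n : ℕ) (x : UnitAddCircle) : L1Circle →L[ℂ] ℂ :=
  ∑ k ∈ Finset.Icc (-(n : ℤ)) (n : ℤ), fourier k x • fourierCoeffCLM k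

lemma partialSumCLM_apply (n : ℕ) (x : UnitAddCircle) (f : L1Circle) :
    partialSumCLM n x f =
      ∑ k ∈ Finset.Icc (-(n : ℤ)) (n : ℤ), fourier k x * fourierCoeffCLM k f := by
  simp [partialSumCLM]

lemma fourierPartialSum_eq_partialSumCLM (n : ℕ) (x : UnitAddCircle) (f : L1Circle) :
    fourierPartialSum n (f : UnitAddCircle → ℂ) x = partialSumCLM n x f := by
  rw [partialSumCLM_apply]
  exact Finset.sum_congr rfl fun k _ => mul_comm _ _

lemma norm_partialSumCLM_apply_le (n : ℕ) (x : UnitAddCircle) (f : L1Circle) :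
    ‖partialSumCLM n x f‖ ≤ (2 * n + 1) * ‖f‖ := by
  rw [partialSumCLM_apply]
  calc ‖∑ k ∈ Finset.Icc (-(n : ℤ)) n, fourier k x * fourierCoeffCLM k f‖
      ≤ ∑ _k ∈ Finset.Icc (-(n : ℤ)) n, ‖f‖ := norm_sum_le_of_le _ fun k _ => by
        rw [norm_mul, norm_fourier_apply, one_mul]
        exact norm_fourierCoeffCLM_apply_le k f
    _ = (2 * n + 1) * ‖f‖ := by
        rw [Finset.sum_const, card_Icc_neg_natCast, nsmul_eq_mul]
        push_cast
        rfl

lemma norm_partialSumCLM_le_of_degree_le {N : ℕ} {h : L1Circle} {C : ℝ}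
    (hdeg : ∀ k : ℤ, (N : ℤ) < |k| → fourierCoeffCLM k h = 0)
    (hcoef : ∀ k : ℤ, ‖fourierCoeffCLM k h‖ ≤ C) (n : ℕ) (x : UnitAddCircle) :
    ‖partialSumCLM n x h‖ ≤ (2 * N + 1) * C := by
  have hC : 0 ≤ C := (norm_nonneg _).trans (hcoef 0)
  have hterm : ∀ k ∈ Finset.Icc (-(n : ℤ)) n, ‖fourier k x * fourierCoeffCLM k h‖ ≤
      if k ∈ Finset.Icc (-(N : ℤ)) N then C else 0 := fun k _ => by
    rw [norm_mul, norm_fourier_apply, one_mul]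
    split_ifs with hk
    · exact hcoef k
    · rw [Finset.mem_Icc, ← abs_le, not_le] at hk
      rw [hdeg k hk, norm_zero]
  rw [partialSumCLM_apply]
  calc ‖∑ k ∈ Finset.Icc (-(n : ℤ)) n, fourier k x * fourierCoeffCLM k h‖
      ≤ ∑ k ∈ Finset.Icc (-(n : ℤ)) n, if k ∈ Finset.Icc (-(N : ℤ)) N then C else 0 :=
        norm_sum_le_of_le _ hterm
    _ = (Finset.Icc (-(n : ℤ)) n ∩ Finset.Icc (-(N : ℤ)) N).card * C := by
        rw [Finset.sum_ite_mem, Finset.sum_const, nsmul_eq_mul]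
    _ ≤ (Finset.Icc (-(N : ℤ)) N).card * C := by
        gcongr
        exact Finset.inter_subset_right
    _ = (2 * N + 1) * C := by
        rw [card_Icc_neg_natCast]
        push_cast
        rfl

lemma fourierCoeffCLM_fourierLp (j k : ℤ) :
    fourierCoeffCLM k (fourierLp 1 j) = if k = j then 1 else 0 := by
  have hL2 : fourierCoeff (fourierLp (T := 1) 2 j : UnitAddCircle → ℂ) k =
      if k = j then 1 else 0 := by
    rw [← fourierBasis_repr, HilbertBasis.repr_apply_apply, coe_fourierBasis]
    exact orthonormal_iff_ite.1 orthonormal_fourier k j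
  rw [fourierCoeffCLM_apply, ← hL2]
  exact congrFun (fourierCoeff_congr_ae
    ((coeFn_fourierLp 1 j).trans (coeFn_fourierLp 2 j).symm)) k

/-- The Fejér kernel `L⁻¹ ∑_{a, b < L} e_{(a - b) q}` of order `L`, dilated by the factor `q` so
that it is concentrated near the multiples of `1 / q`. -/
noncomputable def dilatedFejer (q L : ℕ) : C(UnitAddCircle, ℂ) :=
  (L : ℂ)⁻¹ • ∑ p ∈ Finset.range L ×ˢ Finset.range L, fourier (((p.1 : ℤ) - p.2) * q)

/-- The dilated Fejér kernel as an element of `L¹(𝕋)`. -/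
noncomputable def dilatedFejerL1 (q L : ℕ) : L1Circle :=
  ContinuousMap.toLp (E := ℂ) 1 AddCircle.haarAddCircle ℂ (dilatedFejer q L)

/-- The `k`-th Fourier coefficient of the dilated Fejér kernel, written as a count so that its sign
is evident. -/
noncomputable def fejerWeight (q L : ℕ) (k : ℤ) : ℝ :=
  ((Finset.range L ×ˢ Finset.range L).filter fun p => ((p.1 : ℤ) - p.2) * q = k).card / L

lemma fejerWeight_nonneg (q L : ℕ) (k : ℤ) : 0 ≤ fejerWeight q L k := by
  unfold fejerWeight
  positivity

lemma fourierCoeffCLM_dilatedFejerL1 (q L : ℕ) (k : ℤ) :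
    fourierCoeffCLM k (dilatedFejerL1 q L) = (fejerWeight q L k : ℂ) := by
  rw [dilatedFejerL1, dilatedFejer, map_smul, map_sum, map_smul, map_sum]
  have hterm : ∀ p ∈ Finset.range L ×ˢ Finset.range L,
      fourierCoeffCLM k (ContinuousMap.toLp (E := ℂ) 1 AddCircle.haarAddCircle ℂ
        (fourier (((p.1 : ℤ) - p.2) * q))) = if ((p.1 : ℤ) - p.2) * q = k then 1 else 0 := by
    intro p _
    refine (fourierCoeffCLM_fourierLp _ k).trans ?_
    simp only [eq_comm]
  rw [Finset.sum_congr rfl hterm, Finset.sum_ite, Finset.sum_const_zero, add_zero, Finset.sum_const,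
    fejerWeight, smul_eq_mul, nsmul_eq_mul, mul_one]
  push_cast
  rw [div_eq_inv_mul]

lemma dilatedFejer_apply (q L : ℕ) (t : UnitAddCircle) :
    dilatedFejer q L t =
      (((L : ℝ)⁻¹ * ‖∑ a ∈ Finset.range L, fourier ((a : ℤ) * q) t‖ ^ 2 : ℝ) : ℂ) := by
  have h : ((‖∑ a ∈ Finset.range L, fourier ((a : ℤ) * q) t‖ ^ 2 : ℝ) : ℂ) =
      ∑ p ∈ Finset.range L ×ˢ Finset.range L, fourier (((p.1 : ℤ) - p.2) * q) t := by
    rw [Complex.ofReal_pow, ← Complex.mul_conj', map_sum, Finset.sum_mul_sum, Finset.sum_product]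
    refine Finset.sum_congr rfl fun a _ => Finset.sum_congr rfl fun b _ => ?_
    rw [← fourier_neg, ← fourier_add]
    congr 2
    ring
  rw [Complex.ofReal_mul, h, dilatedFejer]
  simp

lemma fejerWeight_zero {q L : ℕ} (hq : 0 < q) (hL : 0 < L) : fejerWeight q L 0 = 1 := by
  have hq' : (q : ℤ) ≠ 0 := by exact_mod_cast hq.ne'
  have hdiag : ((Finset.range L ×ˢ Finset.range L).filter fun p => ((p.1 : ℤ) - p.2) * q = 0) =
      (Finset.range L).diag := by
    ext p
    simp only [Finset.mem_filter, Finset.mem_product, Finset.mem_diag, mul_eq_zero, hq', or_false]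
    grind
  rw [fejerWeight, hdiag, Finset.diag_card, Finset.card_range, div_self (by positivity)]

lemma fejerWeight_eq_zero {q L : ℕ} {k : ℤ} (h : ¬ (q : ℤ) ∣ k) : fejerWeight q L k = 0 := by
  rw [fejerWeight, Finset.card_eq_zero.2, Nat.cast_zero, zero_div]
  exact Finset.filter_eq_empty_iff.2 fun p _ hp => h (hp ▸ dvd_mul_left _ _)

lemma half_le_fejerWeight {q L : ℕ} {j : ℤ} (hL : 0 < L) (hj : 2 * |j| ≤ L) :
    1 / 2 ≤ fejerWeight q L (j * q) := by
  have hcard : L - j.natAbs ≤ ((Finset.range L ×ˢ Finset.range L).filter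
      fun p => ((p.1 : ℤ) - p.2) * q = j * q).card := by
    conv_lhs => rw [← Finset.card_range (L - j.natAbs)]
    refine Finset.card_le_card_of_injOn (fun b => (b + j.toNat, b + (-j).toNat)) ?_ ?_
    · intro b hb
      simp only [Finset.coe_range, Set.mem_Iio] at hb
      simp only [Finset.coe_filter, Finset.mem_product, Finset.mem_range]
      refine ⟨⟨by omega, by omega⟩, ?_⟩
      congr 1
      push_cast
      omega
    · intro b _ b' _ hbb
      simp only [Prod.mk.injEq] at hbb
      omega
  rw [Int.abs_eq_natAbs] at hj
  rw [fejerWeight, div_le_div_iff₀ (by norm_num) (by exact_mod_cast hL), one_mul]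
  have : L ≤ ((Finset.range L ×ˢ Finset.range L).filter
      fun p => ((p.1 : ℤ) - p.2) * q = j * q).card * 2 := by omega
  exact_mod_cast this

lemma norm_dilatedFejerL1 {q L : ℕ} (hq : 0 < q) (hL : 0 < L) : ‖dilatedFejerL1 q L‖ = 1 := by
  have hae : dilatedFejerL1 q L =ᵐ[AddCircle.haarAddCircle] dilatedFejer q L :=
    ContinuousMap.coeFn_toLp _ _
  -- The Fejér kernel is nonnegative, so its norm is its integral.
  have hnorm : (‖dilatedFejerL1 q L‖ : ℂ) = fourierCoeffCLM 0 (dilatedFejerL1 q L) := by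
    rw [L1.norm_eq_integral_norm, ← integral_complex_ofReal, fourierCoeffCLM_apply, fourierCoeff]
    refine integral_congr_ae (hae.mono fun t ht => ?_)
    beta_reduce
    rw [ht, dilatedFejer_apply, Complex.norm_real, neg_zero, fourier_zero, one_smul,
      Real.norm_of_nonneg (by positivity)]
  rw [fourierCoeffCLM_dilatedFejerL1] at hnorm
  rw [Complex.ofReal_injective hnorm, fejerWeight_zero hq hL]

lemma re_fourier_coe (k : ℤ) (y : ℝ) :
    (fourier k (y : UnitAddCircle)).re = Real.cos (2 * Real.pi * (k * y)) := by
  have harg : (2 * Real.pi * Complex.I * k * y / (1 : ℝ) : ℂ) =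
      ((2 * Real.pi * (k * y) : ℝ) : ℂ) * Complex.I := by
    push_cast
    ring
  rw [fourier_coe_apply, harg, Complex.exp_ofReal_mul_I_re]

lemma half_le_re_fourier {q : ℕ} (hq : 0 < q) {a j : ℤ} {δ : ℝ} (h : |j * q * δ| ≤ 1 / 8) :
    1 / 2 ≤ (fourier (j * q) ((a / q + δ : ℝ) : UnitAddCircle)).re := by
  have hq' : (q : ℝ) ≠ 0 := by positivity
  have harg : 2 * Real.pi * (((j * q : ℤ) : ℝ) * (a / q + δ)) =
      2 * Real.pi * (j * q * δ) + ((j * a : ℤ) : ℝ) * (2 * Real.pi) := by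
    push_cast
    field_simp
    ring
  have hbound : |2 * Real.pi * (j * q * δ)| ≤ Real.pi / 3 := by
    rw [abs_mul, abs_of_pos Real.two_pi_pos]
    nlinarith [Real.pi_pos]
  rw [re_fourier_coe, harg, Real.cos_add_int_mul_two_pi, ← Real.cos_abs, ← Real.cos_pi_div_three]
  exact Real.cos_le_cos_of_nonneg_of_le_pi (abs_nonneg _) (by linarith [Real.pi_pos]) hbound

lemma fejerWeight_mul_re_fourier_nonneg {q L M : ℕ} (hq : 0 < q) {a k : ℤ} {δ : ℝ}
    (hδ : |M * q * δ| ≤ 1 / 8) (hk : |k| ≤ M * q) :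
    0 ≤ fejerWeight q L k * (fourier k ((a / q + δ : ℝ) : UnitAddCircle)).re := by
  by_cases hdvd : (q : ℤ) ∣ k
  · obtain ⟨j, rfl⟩ := hdvd
    rw [mul_comm (q : ℤ) j] at hk ⊢
    have hj : |(j : ℝ) * q| ≤ |(M : ℝ) * q| := by
      rw [abs_of_nonneg (by positivity : (0 : ℝ) ≤ M * q)]
      exact_mod_cast hk
    refine mul_nonneg (fejerWeight_nonneg _ _ _)
      (one_half_pos.le.trans (half_le_re_fourier hq (le_trans ?_ hδ)))
    rw [abs_mul, abs_mul (_ * _)]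
    gcongr
  · rw [fejerWeight_eq_zero hdvd, zero_mul]

lemma le_re_partialSumCLM_dilatedFejerL1 {q L M : ℕ} (hq : 0 < q) (hML : 2 * M ≤ L) {a : ℤ} {δ : ℝ}
    (hδ : |M * q * δ| ≤ 1 / 8) :
    (M : ℝ) / 4 ≤
      (partialSumCLM (M * q) ((a / q + δ : ℝ) : UnitAddCircle) (dilatedFejerL1 q L)).re := by
  set x : UnitAddCircle := ((a / q + δ : ℝ) : UnitAddCircle)
  have hinj : Function.Injective fun j : ℕ => (j : ℤ) * q :=
    (mul_left_injective₀ (by exact_mod_cast hq.ne')).comp Nat.cast_injective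
  have hsub : (Finset.range M).image (fun j : ℕ => (j : ℤ) * q) ⊆
      Finset.Icc (-((M * q : ℕ) : ℤ)) ((M * q : ℕ) : ℤ) := fun k hk => by
    obtain ⟨j, hj, rfl⟩ := Finset.mem_image.1 hk
    have hjM : j * q ≤ M * q := Nat.mul_le_mul_right _ (Finset.mem_range.1 hj).le
    rw [Finset.mem_Icc]
    omega
  calc (M : ℝ) / 4 = ∑ _j ∈ Finset.range M, (1 / 2 : ℝ) * (1 / 2) := by
        rw [Finset.sum_const, Finset.card_range, nsmul_eq_mul]
        ring
    _ ≤ ∑ j ∈ Finset.range M, fejerWeight q L (j * q) * (fourier (j * q) x).re := by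
        refine Finset.sum_le_sum fun j hj => ?_
        rw [Finset.mem_range] at hj
        have hjδ : |((j : ℤ) : ℝ) * q * δ| ≤ 1 / 8 := by
          refine le_trans ?_ hδ
          rw [Int.cast_natCast, mul_assoc, mul_assoc, abs_mul, abs_mul (M : ℝ), Nat.abs_cast,
            Nat.abs_cast]
          gcongr
        exact mul_le_mul (half_le_fejerWeight (by omega) (by rw [Nat.abs_cast]; omega))
          (half_le_re_fourier hq hjδ) (by norm_num) (fejerWeight_nonneg _ _ _)
    _ = ∑ k ∈ (Finset.range M).image fun j : ℕ => (j : ℤ) * q,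
          fejerWeight q L k * (fourier k x).re := by
        rw [Finset.sum_image hinj.injOn]
    _ ≤ ∑ k ∈ Finset.Icc (-((M * q : ℕ) : ℤ)) ((M * q : ℕ) : ℤ),
          fejerWeight q L k * (fourier k x).re :=
        Finset.sum_le_sum_of_subset_of_nonneg hsub fun k hk _ =>
          fejerWeight_mul_re_fourier_nonneg hq hδ (by simpa [abs_le] using hk)
    _ = (partialSumCLM (M * q) x (dilatedFejerL1 q L)).re := by
        rw [partialSumCLM_apply, Complex.re_sum]
        refine Finset.sum_congr rfl fun k _ => ?_
        rw [fourierCoeffCLM_dilatedFejerL1, mul_comm, Complex.re_mul_ofReal]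

/-- The spike of level `N`: an `L¹`-normalized kernel concentrated near the multiples of `2⁻ᴺ`,
whose Fourier coefficients are at least `1 / 2` at the multiples of `2 ^ N` up to `2 ^ (N ^ 2 + N)`.
-/
noncomputable def spike (N : ℕ) : L1Circle := dilatedFejerL1 (2 ^ N) (2 ^ (N ^ 2 + 1))

lemma norm_spike (N : ℕ) : ‖spike N‖ = 1 := norm_dilatedFejerL1 (by positivity) (by positivity)

/-- The function `f` is close to a trigonometric polynomial of degree at most `N` plus a small
multiple of the spike of level `N`. The error is so small that it adds at most `1` to the partial
sums of order at most `2 ^ N ^ 2`. -/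
def HasSpikeAt (f : L1Circle) (N : ℕ) : Prop :=
  ∃ h : L1Circle, (∀ k : ℤ, (N : ℤ) < |k| → fourierCoeffCLM k h = 0) ∧
    (∀ k : ℤ, ‖fourierCoeffCLM k h‖ ≤ N) ∧
    ‖f - (h + (N : ℂ)⁻¹ • spike N)‖ < (2 ^ (N ^ 2 + 2))⁻¹

lemma isOpen_setOf_hasSpikeAt (N : ℕ) : IsOpen {f | HasSpikeAt f N} := by
  have hunion : {f | HasSpikeAt f N} = ⋃ h ∈ {h : L1Circle | (∀ k : ℤ, (N : ℤ) < |k| →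
      fourierCoeffCLM k h = 0) ∧ ∀ k : ℤ, ‖fourierCoeffCLM k h‖ ≤ N},
      Metric.ball (h + (N : ℂ)⁻¹ • spike N) (2 ^ (N ^ 2 + 2))⁻¹ := by
    ext f
    simp only [HasSpikeAt, Set.mem_iUnion, Metric.mem_ball, dist_eq_norm, exists_prop]
    exact exists_congr fun h => (and_assoc (c := _ < _)).symm
  rw [hunion]
  exact isOpen_biUnion fun h _ => Metric.isOpen_ball

lemma eventually_fourierCoeffCLM_eq_zero {h : L1Circle}
    (hh : h ∈ Submodule.span ℂ (Set.range (fourierLp (T := 1) 1))) :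
    ∀ᶠ N : ℕ in atTop, ∀ k : ℤ, (N : ℤ) < |k| → fourierCoeffCLM k h = 0 := by
  induction hh using Submodule.span_induction with
  | mem x hx =>
    obtain ⟨j, rfl⟩ := hx
    filter_upwards [eventually_ge_atTop j.natAbs] with N hN k hk
    rw [fourierCoeffCLM_fourierLp, if_neg]
    rintro rfl
    rw [Int.abs_eq_natAbs] at hk
    omega
  | zero => simp
  | add x y _ _ hx hy =>
    filter_upwards [hx, hy] with N h1 h2 k hk
    rw [map_add, h1 k hk, h2 k hk, add_zero]
  | smul c x _ hx =>
    filter_upwards [hx] with N h1 k hk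
    rw [map_smul, h1 k hk, smul_zero]

lemma dense_setOf_exists_hasSpikeAt (K : ℕ) : Dense {f | ∃ N ≥ K, HasSpikeAt f N} := by
  rw [Metric.dense_iff]
  intro f r hr
  have hmem : f ∈ closure (Submodule.span ℂ (Set.range (fourierLp (T := 1) 1)) : Set L1Circle) := by
    rw [← Submodule.topologicalClosure_coe, span_fourierLp_closure_eq_top ENNReal.one_ne_top]
    trivial
  obtain ⟨h, hspan, hfh⟩ := Metric.mem_closure_iff.1 hmem (r / 2) (half_pos hr)
  have hinv : ∀ᶠ N : ℕ in atTop, ((N : ℝ))⁻¹ < r / 2 :=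
    tendsto_inv_atTop_nhds_zero_nat.eventually_lt_const (half_pos hr)
  obtain ⟨N, hdeg, hNK, hNr, hNh⟩ := ((eventually_fourierCoeffCLM_eq_zero hspan).and
    ((eventually_ge_atTop K).and (hinv.and
      (tendsto_natCast_atTop_atTop.eventually_ge_atTop ‖h‖)))).exists
  refine ⟨h + (N : ℂ)⁻¹ • spike N, ?_, N, hNK, h, hdeg, fun k => ?_, ?_⟩
  · have hspike : ‖(N : ℂ)⁻¹ • spike N‖ < r / 2 := by
      rwa [norm_smul, norm_spike, norm_inv, Complex.norm_natCast, mul_one]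
    rw [dist_comm, dist_eq_norm] at hfh
    rw [Metric.mem_ball, dist_eq_norm, add_sub_right_comm]
    exact (norm_add_le _ _).trans_lt (by linarith)
  · exact (norm_fourierCoeffCLM_apply_le k h).trans hNh
  · rw [sub_self, norm_zero]
    positivity

theorem eventually_residual_frequently_hasSpikeAt :
    ∀ᶠ f : L1Circle in residual L1Circle, ∃ᶠ N : ℕ in atTop, HasSpikeAt f N := by
  have hlarge : ∀ K : ℕ, ∀ᶠ f : L1Circle in residual L1Circle, ∃ N ≥ K, HasSpikeAt f N := by
    intro K
    have hunion : {f | ∃ N ≥ K, HasSpikeAt f N} = ⋃ N ∈ Set.Ici K, {f | HasSpikeAt f N} := by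
      ext f
      simp
    have hopen : IsOpen {f | ∃ N ≥ K, HasSpikeAt f N} :=
      hunion ▸ isOpen_biUnion fun N _ => isOpen_setOf_hasSpikeAt N
    exact residual_of_dense_open hopen (dense_setOf_exists_hasSpikeAt K)
  filter_upwards [eventually_countable_forall.2 hlarge] with f hf
  exact frequently_atTop.2 hf

lemma le_norm_partialSumCLM_spike {N j : ℕ} (hj : N + j ≤ N ^ 2) {a : ℤ} {δ : ℝ} (hδ0 : 0 ≤ δ)
    (hδ : δ ≤ ((2 : ℝ) ^ (N + j + 3))⁻¹) :
    (2 : ℝ) ^ j / 4 ≤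
      ‖partialSumCLM (2 ^ (N + j)) ((a / 2 ^ N + δ : ℝ) : UnitAddCircle) (spike N)‖ := by
  have hML : 2 * 2 ^ j ≤ 2 ^ (N ^ 2 + 1) := by
    rw [← pow_succ']
    exact Nat.pow_le_pow_right two_pos (by omega)
  have hsmall : |((2 ^ j : ℕ) : ℝ) * ((2 ^ N : ℕ) : ℝ) * δ| ≤ 1 / 8 := by
    rw [← Nat.cast_mul, ← pow_add, add_comm j, abs_of_nonneg (by positivity)]
    push_cast
    calc (2 : ℝ) ^ (N + j) * δ ≤ 2 ^ (N + j) * ((2 : ℝ) ^ (N + j + 3))⁻¹ := by gcongr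
      _ = 1 / 8 := by
        rw [pow_add _ (N + j)]
        field_simp
        norm_num
  have hre := le_re_partialSumCLM_dilatedFejerL1 (a := a) (by positivity) hML hsmall
  rw [← pow_add, add_comm j] at hre
  push_cast at hre
  exact hre.trans (Complex.re_le_norm _)

lemma HasSpikeAt.le_norm_fourierPartialSum {f : L1Circle} {N j : ℕ} (hf : HasSpikeAt f N)
    (hj : N + j ≤ N ^ 2) {a : ℤ} {δ : ℝ} (hδ0 : 0 ≤ δ)
    (hδ : δ ≤ ((2 : ℝ) ^ (N + j + 3))⁻¹) :
    (2 : ℝ) ^ j / (4 * N) - ((2 * N + 1) * N + 1) ≤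
      ‖fourierPartialSum (2 ^ (N + j)) f ((a / 2 ^ N + δ : ℝ) : UnitAddCircle)‖ := by
  obtain ⟨h, hdeg, hcoef, hclose⟩ := hf
  set x := ((a / 2 ^ N + δ : ℝ) : UnitAddCircle)
  set S := partialSumCLM (2 ^ (N + j)) x
  set e := f - (h + (N : ℂ)⁻¹ • spike N) with he
  have hspike : (2 : ℝ) ^ j / (4 * N) ≤ ‖(N : ℂ)⁻¹ * S (spike N)‖ := by
    rw [norm_mul, norm_inv, Complex.norm_natCast, ← div_div, div_eq_inv_mul _ (N : ℝ)]
    gcongr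
    exact le_norm_partialSumCLM_spike hj hδ0 hδ
  have hpoly : ‖S h‖ ≤ (2 * N + 1) * N := norm_partialSumCLM_le_of_degree_le hdeg hcoef _ x
  have herror : ‖S e‖ ≤ 1 := by
    have hpow : (2 : ℝ) ^ (N + j) ≤ 2 ^ N ^ 2 := pow_le_pow_right₀ one_le_two hj
    have hone : (1 : ℝ) ≤ 2 ^ N ^ 2 := one_le_pow₀ one_le_two
    calc ‖S e‖ ≤ (2 * (2 ^ (N + j) : ℕ) + 1) * ‖e‖ := norm_partialSumCLM_apply_le _ x e
      _ ≤ 2 ^ (N ^ 2 + 2) * (2 ^ (N ^ 2 + 2))⁻¹ := by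
        gcongr
        rw [pow_add 2 (N ^ 2)]
        push_cast
        linarith
      _ = 1 := mul_inv_cancel₀ (by positivity)
  have hsum : S f = (N : ℂ)⁻¹ * S (spike N) + (S h + S e) := by
    rw [he, map_sub, map_add, map_smul, smul_eq_mul]
    ring
  rw [fourierPartialSum_eq_partialSumCLM, hsum]
  have := norm_sub_le_norm_add ((N : ℂ)⁻¹ * S (spike N)) (S h + S e)
  linarith [norm_add_le (S h) (S e)]

/-- The offset `j` for which a spike of level `N` makes the partial sum of order `2 ^ (N + j)`
larger than the `β`-th power of its order. The term `32 * N ^ 3` absorbs the factor `N⁻¹` and the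
contribution of the polynomial part in `HasSpikeAt.le_norm_fourierPartialSum`. -/
noncomputable def spikeOffset (β : ℝ) (N : ℕ) : ℕ :=
  ⌈(β * N + Real.logb 2 (32 * N ^ 3)) / (1 - β)⌉₊

lemma logb_thirtytwo_mul_pow_nonneg {N : ℕ} (hN : 1 ≤ N) : 0 ≤ Real.logb 2 (32 * (N : ℝ) ^ 3) := by
  have hN' : (1 : ℝ) ≤ N ^ 3 := one_le_pow₀ (by exact_mod_cast hN)
  exact Real.logb_nonneg one_lt_two (by linarith)

lemma rpow_le_spike_bound {β : ℝ} (hβ0 : 0 ≤ β) (hβ1 : β < 1) {N : ℕ} (hN : 1 ≤ N) :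
    ((2 : ℝ) ^ (N + spikeOffset β N)) ^ β ≤
      2 ^ spikeOffset β N / (4 * N) - ((2 * N + 1) * N + 1) := by
  set j := spikeOffset β N with hj
  set G := ((2 : ℝ) ^ (N + j)) ^ β with hG
  have hN' : (1 : ℝ) ≤ N := by exact_mod_cast hN
  have hexp : Real.logb 2 (32 * N ^ 3) + ((N + j : ℕ) : ℝ) * β ≤ j := by
    have := Nat.le_ceil ((β * N + Real.logb 2 (32 * N ^ 3)) / (1 - β))
    rw [← spikeOffset, ← hj, div_le_iff₀ (by linarith)] at this
    push_cast
    linarith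
  have hmain : 32 * (N : ℝ) ^ 3 * G ≤ 2 ^ j := by
    have := Real.rpow_le_rpow_of_exponent_le one_le_two hexp
    rwa [Real.rpow_add two_pos, Real.rpow_logb two_pos (by norm_num) (by positivity),
      Real.rpow_mul zero_le_two, Real.rpow_natCast, Real.rpow_natCast, ← hG] at this
  have hG1 : 1 ≤ G := Real.one_le_rpow (one_le_pow₀ one_le_two) hβ0
  have hpoly : G + ((2 * N + 1) * N + 1) ≤ G * (5 * (N : ℝ) ^ 2) := by
    have hG : G ≤ G * (N : ℝ) ^ 2 := le_mul_of_one_le_right (by positivity) (one_le_pow₀ hN')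
    have hN4 : (2 * N + 1) * N + 1 ≤ 4 * (N : ℝ) ^ 2 := by nlinarith
    linarith [le_mul_of_one_le_left (by positivity : 0 ≤ 4 * (N : ℝ) ^ 2) hG1]
  rw [le_sub_iff_add_le, le_div_iff₀ (by positivity)]
  calc (G + ((2 * N + 1) * N + 1)) * (4 * N)
      ≤ (G * (5 * (N : ℝ) ^ 2)) * (4 * N) := by
        gcongr
    _ ≤ 32 * (N : ℝ) ^ 3 * G := by
        have : 0 ≤ (N : ℝ) ^ 3 * G := by positivity
        linarith
    _ ≤ 2 ^ j := hmain

lemma eventually_logb_add_le (C : ℝ) {c : ℝ} (hc : 0 < c) :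
    ∀ᶠ N : ℕ in atTop, Real.logb 2 (32 * (N : ℝ) ^ 3) + C ≤ c * N := by
  have hlog : ∀ᶠ N : ℕ in atTop, ‖Real.log N‖ ≤ c * Real.log 2 / 6 * ‖(N : ℝ)‖ :=
    tendsto_natCast_atTop_atTop.eventually
      (Real.isLittleO_log_id_atTop.bound (by positivity : 0 < c * Real.log 2 / 6))
  have hlin : ∀ᶠ N : ℕ in atTop, 5 + C ≤ c / 2 * N :=
    (tendsto_natCast_atTop_atTop.const_mul_atTop (half_pos hc)).eventually_ge_atTop _
  filter_upwards [hlog, hlin, eventually_ge_atTop 1] with N hlogN hlinN hN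
  have hN0 : (N : ℝ) ≠ 0 := by positivity
  have hsplit : Real.logb 2 (32 * (N : ℝ) ^ 3) = 5 + 3 * Real.logb 2 N := by
    rw [Real.logb_mul (by norm_num) (pow_ne_zero 3 hN0), Real.logb_pow,
      show (32 : ℝ) = 2 ^ 5 by norm_num, Real.logb_pow, Real.logb_self_eq_one one_lt_two]
    norm_num
  have hlogb : Real.logb 2 N ≤ c / 6 * N := by
    rw [Real.logb, div_le_iff₀ (Real.log_pos one_lt_two)]
    calc Real.log N ≤ c * Real.log 2 / 6 * ‖(N : ℝ)‖ := (le_abs_self _).trans hlogN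
      _ = c / 6 * N * Real.log 2 := by
          rw [Real.norm_natCast]
          ring
  linarith

lemma eventually_mul_add_spikeOffset_le {β s : ℝ} (hβ0 : 0 ≤ β) (hs0 : 0 < s) (hs : s < 1 - β) :
    ∀ᶠ N : ℕ in atTop, s * (N + spikeOffset β N + 3 : ℕ) ≤ N := by
  have hτ : 0 < 1 - β := hs0.trans hs
  have hc : 0 < (1 - β - s) / s := div_pos (by linarith) hs0
  filter_upwards [eventually_logb_add_le (4 * (1 - β)) hc, eventually_ge_atTop 1] with N hN hN1
  have hoffset : (spikeOffset β N : ℝ) * (1 - β) ≤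
      β * N + Real.logb 2 (32 * N ^ 3) + (1 - β) := by
    have := logb_thirtytwo_mul_pow_nonneg hN1
    have hlt : (spikeOffset β N : ℝ) < _ := Nat.ceil_lt_add_one
      (show 0 ≤ (β * N + Real.logb 2 (32 * N ^ 3)) / (1 - β) by positivity)
    rw [← sub_lt_iff_lt_add, lt_div_iff₀ hτ] at hlt
    linarith
  rw [div_mul_eq_mul_div, le_div_iff₀ hs0] at hN
  have hmul := mul_le_mul_of_nonneg_left hoffset hs0.le
  refine le_of_mul_le_mul_right ?_ hτ
  push_cast
  linarith

lemma eventually_add_spikeOffset_le_sq {β : ℝ} (hβ0 : 0 ≤ β) (hβ1 : β < 1) :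
    ∀ᶠ N : ℕ in atTop, N + spikeOffset β N ≤ N ^ 2 := by
  obtain ⟨s, hs0, hs⟩ := exists_between (sub_pos.2 hβ1)
  filter_upwards [eventually_mul_add_spikeOffset_le hβ0 hs0 hs,
    (tendsto_natCast_atTop_atTop.const_mul_atTop hs0).eventually_ge_atTop (1 : ℝ)] with N hN hN'
  have hle : s * (N + spikeOffset β N : ℕ) ≤ s * (N ^ 2 : ℕ) := by
    calc s * (N + spikeOffset β N : ℕ) ≤ s * (N + spikeOffset β N + 3 : ℕ) :=
          mul_le_mul_of_nonneg_left (by exact_mod_cast Nat.le_add_right _ 3) hs0.le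
      _ ≤ 1 * N := by rwa [one_mul]
      _ ≤ s * N * N := by gcongr
      _ = s * (N ^ 2 : ℕ) := by
          push_cast
          ring
  exact_mod_cast le_of_mul_le_mul_left hle hs0

section LowerBound

variable {f : UnitAddCircle → ℂ} {β : ℝ}

lemma measurableSet_fastGrowthSet (γ : ℝ) : MeasurableSet (fastGrowthSet γ f) := by
  have hcont : ∀ n, Continuous (fourierPartialSum n f) := fun n => by
    unfold fourierPartialSum
    fun_prop
  have hunion : fastGrowthSet γ f =
      ⋂ K : ℕ, ⋃ n ≥ K, {x | (n : ℝ) ^ γ ≤ ‖fourierPartialSum n f x‖} := by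
    ext x
    simp [fastGrowthSet, frequently_atTop]
  rw [hunion]
  exact .iInter fun K => .biUnion (Set.to_countable _) fun n _ =>
    (isClosed_le continuous_const (hcont n).norm).measurableSet

lemma ae_notMem_fastGrowthSet (hf : Integrable f AddCircle.haarAddCircle)
    {ν : Measure UnitAddCircle} (hβ0 : 0 ≤ β) (hβ1 : β < 1)
    (hac : ∀ s : ℝ, 0 < s → s < 1 - β → ν ≪ μH[s]) {γ : ℝ} (hγ : β < γ) :
    ∀ᵐ x ∂ν, x ∉ fastGrowthSet γ f := by
  obtain ⟨s, hs, hsβ⟩ := exists_between (max_lt (sub_pos.2 hβ1) (sub_lt_sub_left hγ 1))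
  obtain ⟨hs0, hsγ⟩ := max_lt_iff.1 hs
  lift s to ℝ≥0 using hs0.le
  refine measure_eq_zero_iff_ae_notMem.1 (hac s hs0 hsβ (hausdorffMeasure_of_dimH_lt ?_))
  refine (dimH_fastGrowthSet_le hf (hβ0.trans_lt hγ)).trans_lt ?_
  rwa [← ENNReal.ofReal_coe_nnreal, ENNReal.ofReal_lt_ofReal_iff hs0]

lemma ofReal_le_dimH_divergenceLevelSet (hf : Integrable f AddCircle.haarAddCircle)
    {ν : Measure UnitAddCircle} (hν : ν ≠ 0) (hβ0 : 0 ≤ β) (hβ1 : β < 1)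
    (hac : ∀ s : ℝ, 0 < s → s < 1 - β → ν ≪ μH[s]) (hfast : ∀ᵐ x ∂ν, x ∈ fastGrowthSet β f) :
    ENNReal.ofReal (1 - β) ≤ dimH (divergenceLevelSet β f) := by
  have hslow : ∀ᵐ x ∂ν, ∀ k : ℕ, x ∉ fastGrowthSet (β + 1 / ((k : ℝ) + 1)) f :=
    ae_all_iff.2 fun k => ae_notMem_fastGrowthSet hf hβ0 hβ1 hac
      (lt_add_of_pos_right _ Nat.one_div_pos_of_nat)
  refine ofReal_le_dimH_of_ae_mem hν hac ?_
  filter_upwards [hfast, hslow] with x hx hx'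
  refine le_antisymm (EReal.le_of_forall_lt_iff_le.1 fun γ hγ => ?_)
    (le_growthExponent_of_mem_fastGrowthSet hx)
  obtain ⟨k, hk⟩ := exists_nat_one_div_lt (sub_pos.2 (EReal.coe_lt_coe_iff.1 hγ))
  by_contra! hlt
  exact hx' k (fastGrowthSet_anti (by linarith) (mem_fastGrowthSet_of_lt_growthExponent hlt))

end LowerBound

section Spiky

variable {f : L1Circle} {β : ℝ} {N : ℕ → ℕ}

lemma coe_digitMap_mem_fastGrowthSet {P : ℕ → Prop} [DecidablePred P] (hβ0 : 0 ≤ β) (hβ1 : β < 1)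
    (hN : Tendsto N atTop atTop) (hspike : ∀ i, HasSpikeAt f (N i))
    (hP : ∀ i k, N i ≤ k → k < N i + spikeOffset β (N i) + 3 → ¬ P k) (t : ℝ) :
    (digitMap P t : UnitAddCircle) ∈ fastGrowthSet β f := by
  have horder : Tendsto (fun i => 2 ^ (N i + spikeOffset β (N i))) atTop atTop :=
    (tendsto_pow_atTop_atTop_of_one_lt one_lt_two).comp
      (tendsto_atTop_mono (fun i => Nat.le_add_right _ _) hN)
  refine horder.frequently (Eventually.frequently ?_)
  filter_upwards [hN.eventually (eventually_add_spikeOffset_le_sq hβ0 hβ1),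
    hN.eventually_ge_atTop 1] with i hsq hi
  have hgrowth := (hspike i).le_norm_fourierPartialSum (a := digitApprox P (N i) t) hsq
    (sub_nonneg.2 (le_digitMap _ _)) (digitMap_sub_le_of_gap (by omega) (hP i) t)
  rw [Int.cast_natCast, add_sub_cancel] at hgrowth
  push_cast
  exact (rpow_le_spike_bound hβ0 hβ1 hi).trans hgrowth

lemma exists_strictMono_le_succ_of_frequently {p : ℕ → Prop} (h : ∃ᶠ n in atTop, p n)
    (g : ℕ → ℕ → ℕ) :
    ∃ N : ℕ → ℕ, StrictMono N ∧ (∀ i, p (N i)) ∧ ∀ i, g i (N i) ≤ N (i + 1) := by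
  choose next hnext hp using fun K => (frequently_atTop.1 h) K
  let N : ℕ → ℕ := fun i => Nat.rec (next 0) (fun i n => next (max (n + 1) (g i n))) i
  have hN : ∀ i, max (N i + 1) (g i (N i)) ≤ N (i + 1) := fun i => hnext _
  refine ⟨N, strictMono_nat_of_lt_succ fun i => (le_max_left _ _).trans (hN i), fun i => ?_,
    fun i => (le_max_right _ _).trans (hN i)⟩
  cases i <;> exact hp _

theorem ofReal_le_dimH_divergenceLevelSet_of_frequently_hasSpikeAt
    (hf : ∃ᶠ N : ℕ in atTop, HasSpikeAt f N) (hβ0 : 0 ≤ β) (hβ1 : β < 1) :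
    ENNReal.ofReal (1 - β) ≤ dimH (divergenceLevelSet β f) := by
  classical
  obtain ⟨N, hN, hspike, hsep⟩ := exists_strictMono_le_succ_of_frequently hf
    fun i n => (i + 1) * (n + spikeOffset β n + 3)
  set P := OutsideGaps N fun i => N i + spikeOffset β (N i) + 3
  refine ofReal_le_dimH_divergenceLevelSet (L1.integrable_coeFn f) (digitMeasure_ne_zero (P := P))
    hβ0 hβ1 (fun s hs hsβ => ?_) ?_
  · obtain ⟨s'', hs'', hs''β⟩ := exists_between hsβ
    obtain ⟨s', hs', hs's''⟩ := exists_between hs''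
    refine Measure.absolutelyContinuous_of_le (digitMeasure_le_hausdorffMeasure
      (fun h => h.1 rfl) hs hs' (eventually_mul_le_count_outsideGaps (hs.trans hs').le hs's'' hN
        (fun i => by omega) hsep ?_))
    exact hN.tendsto_atTop.eventually
      (eventually_mul_add_spikeOffset_le hβ0 (hs.trans hs'') hs''β)
  · exact (ae_map_iff (p := (· ∈ fastGrowthSet β f)) measurable_coe_digitMap.aemeasurable
      (measurableSet_fastGrowthSet β)).2 <| .of_forall <|
        coe_digitMap_mem_fastGrowthSet hβ0 hβ1 hN.tendsto_atTop hspike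
          fun i k hk hk' h => h.2 i ⟨hk, hk'⟩

end Spiky

theorem theorem3 :
    ∀ᶠ f : L1Circle in residual L1Circle,
      ∀ β : ℝ, 0 ≤ β → β ≤ 1 →
        dimH (divergenceLevelSet β (f : UnitAddCircle → ℂ)) = ENNReal.ofReal (1 - β) := by
  filter_upwards [eventually_residual_frequently_hasSpikeAt] with f hf β hβ0 hβ1
  refine le_antisymm (dimH_divergenceLevelSet_le (L1.integrable_coeFn f) hβ0) ?_
  rcases hβ1.eq_or_lt with rfl | hβ1
  · simp
  · exact ofReal_le_dimH_divergenceLevelSet_of_frequently_hasSpikeAt hf hβ0 hβ1
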